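/- Let $n,m,p$ be positive integers and let $\mathscr M\subset M_n(\mathbb R)\times M_{n,m}(\mathbb R)\times M_{p,n}(\mathbb R)$ be nonempty and bounded; write $\mathscr M_A$ for its projection on the first factor. For a set $\mathscr N$ of matrices, or of triples of matrices, and $t\ge 0$, let $\mathcal F^{\rm arb}_t(\mathscr N)$ be the set of measurable signals $[0,t]\to\mathscr N$ (identified when equal almost everywhere) and $\mathcal F^{\rm pc}_t(\mathscr N)$ the set of signals $[0,t]\to\mathscr N$ with finitely many values and finitely many discontinuities. Let $\mathcal T$ be a class of measurable signals $[0,\infty)\to\mathscr M$, and let $\mathcal G=\bigcup_{t\ge0}\mathcal G_t$ with $\mathcal G_t\subset\mathcal F^{\rm arb}_t(\mathscr M)$ be such that every infinite concatenation $\sigma_0*\sigma_1*\cdots$ of signals $\sigma_k\in\mathcal G_{t_k}$ with $\sum_k t_k=\infty$ belongs to $\mathcal T$. Put $\mathcal G_{A,t}=\{A(\cdot)\mid (A,B,C)(\cdot)\in\mathcal G_t\}$. Let $\Phi_A(t,s)$ be the flow of $\dot x=A(\cdot)x$ from time $s$ to time $t$. For a signal $\sigma=(A,B,C)$ on $[0,t]$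 put $$W^c_\sigma(t)=\int_0^t\Phi_A(0,s)B(s)B(s)^T\Phi_A(0,s)^T\,ds,\qquad W^o_\sigma(t)=\int_0^t\Phi_A(s,0)^TC(s)^TC(s)\Phi_A(s,0)\,ds$$ (the controllability and observability Gramians in time $t$). Assume that $(\mathcal T,\mathcal G)$ satisfies the following Assumption T2. (a) For all $t,\varepsilon>0$ and $A\in\mathcal F^{\rm pc}_t(\mathscr M_A)$ there is a path $(0,1]\ni\lambda\mapsto(t_\lambda,A_\lambda)$ with $t_\lambda>0$ and $A_\lambda\in\mathcal F^{\rm arb}_{t_\lambda}(\mathscr M_A)$ such that $\lambda\mapsto\Phi_{A_\lambda}(t_\lambda,0)$ is analytic, $\|\Phi_{A_1}(t_1,0)-\Phi_A(t,0)\|\le\varepsilon$, and $\{\lambda\in(0,1]\mid A_\lambda\in\mathcal G_{A,t_\lambda}\}$ has nonempty interior. (b) For all $t,\varepsilon>0$ and $\sigma\in\mathcal F^{\rm pc}_t(\mathscr M)$ there is a path $[0,1]\ni\lambda\mapsto(t_\lambda,\sigma_\lambda)$ with $t_\lambda>0$ and $\sigma_\lambda\in\mathcal F^{\rm arb}_{t_\lambda}(\mathscr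 M)$ such that $\lambda\mapsto\bigl(W^c_{\sigma_\lambda}(t_\lambda),W^o_{\sigma_\lambda}(t_\lambda)\bigr)$ is analytic, $\|W^c_{\sigma_1}(t_1)-W^c_\sigma(t)\|\le\varepsilon$, $\|W^o_{\sigma_1}(t_1)-W^o_\sigma(t)\|\le\varepsilon$, and $\{\lambda\in[0,1]\mid\sigma_\lambda\in\mathcal G_{t_\lambda}\}$ has nonempty interior. For a family $\mathcal H=\bigcup_{t\ge0}\mathcal H_t$ of signals let $\mathfrak R(\mathcal H)$ be the set of $x\in\mathbb R^n$ for which there are $t\ge0$, $(A,B,C)\in\mathcal H_t$ and $u\in L_2([0,\infty),\mathbb R^m)$ such that the solution of $\dot x=A(\cdot)x+B(\cdot)u$, $x(0)=0$, equals $x$ at time $t$. Let $$\mathcal V_1=\operatorname{Span}\{A^jb_l\mid 0\le j\le n-1,\ 1\le l\le m,\ (A,[b_1\cdots b_m],C)\in\mathscr M\},$$ $$\mathcal V_{k+1}=\operatorname{Span}\{A^jv\mid 0\le j\le n-1,\ A\in\mathscr M_A,\ v\in\mathcal V_k\}\quad(k\ge1),\qquad \mathcal V(\mathscr M)=\sum_{k\ge1}\mathcal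 V_k.$$ Then $$\mathfrak R(\mathcal G)=\mathfrak R(\mathcal F^{\rm arb}(\mathscr M))=\mathcal V(\mathscr M),$$ and there exist $t^*>0$ and $\sigma\in\mathcal G_{t^*}$ such that the range of $W^c_\sigma(t^*)$ is equal to $\mathcal V(\mathscr M)$. -/

import Mathlib

open Set Filter Topology MeasureTheory
open scoped Matrix Matrix.Norms.L2Operator

noncomputable section

namespace SwitchedSystem

/-- Triples `(A, B, C)` of matrices in `M_n(ℝ) × M_{n,m}(ℝ) × M_{p,n}(ℝ)`. Matrices carry the
operator norm induced by the Euclidean norms. -/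
abbrev Triple (n m p : ℕ) : Type :=
  Matrix (Fin n) (Fin n) ℝ × Matrix (Fin n) (Fin m) ℝ × Matrix (Fin p) (Fin n) ℝ

/-! ### Classes of signals

A signal on `[0, t]` (or on `[0, ∞)`) is represented by a function on `ℝ`, of which only the
restriction to `[0, t]` (or to `[0, ∞)`), up to equality almost everywhere, is used. -/

/-- Measurable signals on `[0, t]` with values in `M` (almost everywhere). When `M` is bounded this
is `L_∞([0, t], M)`: the arbitrarily switching signals on `[0, t]`. -/
def arbSignals {V : Type*} [TopologicalSpace V] (M : Set V) (t : ℝ) : Set (ℝ → V) :=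
  {σ | AEStronglyMeasurable σ (volume.restrict (Icc 0 t)) ∧
    ∀ᵐ s ∂(volume.restrict (Icc 0 t)), σ s ∈ M}

/-- Measurable signals on `[0, ∞)` with values in `M` (almost everywhere). When `M` is bounded this
is `L_∞([0, ∞), M)`. -/
def arbSignalsInfinite {V : Type*} [TopologicalSpace V] (M : Set V) : Set (ℝ → V) :=
  {σ | AEStronglyMeasurable σ (volume.restrict (Ici 0)) ∧
    ∀ᵐ s ∂(volume.restrict (Ici 0)), σ s ∈ M}

/-- Piecewise constant signals on `[0, t]` with values in `M`: finitely many discontinuities and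
finitely many values on `[0, t]`. -/
def pcSignals {V : Type*} [TopologicalSpace V] (M : Set V) (t : ℝ) : Set (ℝ → V) :=
  {σ | (∀ s ∈ Icc 0 t, σ s ∈ M) ∧
    {s ∈ Icc 0 t | ¬ ContinuousWithinAt σ (Icc 0 t) s}.Finite ∧ (σ '' Icc 0 t).Finite}

/-- The infinite concatenations `σ₀ * σ₁ * σ₂ * ⋯` of signals `σ_k ∈ G_{d_k}` with
`∑ d_k = ∞`: on the interval `(d_0 + ⋯ + d_{k-1}, d_0 + ⋯ + d_k]` the signal is the translate of
`σ_k` (up to a null set). -/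
def concatInfinite {V : Type*} (G : ℝ → Set (ℝ → V)) : Set (ℝ → V) :=
  {σ | ∃ (d : ℕ → ℝ) (τ : ℕ → ℝ → V), (∀ k, 0 ≤ d k ∧ τ k ∈ G (d k)) ∧
    Tendsto (fun N => ∑ i ∈ Finset.range N, d i) atTop atTop ∧
    ∀ k, ∀ᵐ s, s ∈ Ioc (∑ i ∈ Finset.range k, d i) (∑ i ∈ Finset.range (k + 1), d i) →
      σ s = τ k (s - ∑ i ∈ Finset.range k, d i)}

/-- The family `G_A = π_A(G)`, `(G_A)_t = {A | (A, B, C) ∈ G_t}`. -/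
def familyA {n m p : ℕ} (G : ℝ → Set (ℝ → Triple n m p)) (t : ℝ) :
    Set (ℝ → Matrix (Fin n) (Fin n) ℝ) :=
  (fun (σ : ℝ → Triple n m p) (s : ℝ) => (σ s).1) '' G t

/-! ### Flows and Gramians -/

/-- `Φ` is, on the interval between `s` and `t` (in either order), the Carathéodory solution of
`Φ' = A Φ`, `Φ(s) = Id`, in integral form. -/
structure IsFundamentalSolution {n : ℕ} (A : ℝ → Matrix (Fin n) (Fin n) ℝ) (s t : ℝ)
    (Φ : ℝ → Matrix (Fin n) (Fin n) ℝ) : Prop where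
  continuousOn : ContinuousOn Φ (uIcc s t)
  eq_integral : ∀ r ∈ uIcc s t, Φ r = 1 + ∫ τ in s..r, A τ * Φ τ

open Classical in
/-- The flow `Φ_A(t, s)` of `x' = A x` from time `s` to time `t`. For `t < s` the equation is solved
backwards in time. (Fundamental solutions exist and are unique on the interval between `s` and `t`
for measurable essentially bounded `A`; the value `0` is used only when none exists.) -/
def flow {n : ℕ} (A : ℝ → Matrix (Fin n) (Fin n) ℝ) (t s : ℝ) : Matrix (Fin n) (Fin n) ℝ :=
  if h : ∃ Φ, IsFundamentalSolution A s t Φ then h.choose t else 0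

/-- The controllability Gramian
`W^c(t) = ∫₀ᵗ Φ_A(0,s) B(s) B(s)ᵀ Φ_A(0,s)ᵀ ds` of the signal `σ = (A, B, C)`. -/
def ctrlGramian {n m p : ℕ} (σ : ℝ → Triple n m p) (t : ℝ) : Matrix (Fin n) (Fin n) ℝ :=
  ∫ s in (0 : ℝ)..t,
    flow (fun r => (σ r).1) 0 s * (σ s).2.1 * (σ s).2.1ᵀ * (flow (fun r => (σ r).1) 0 s)ᵀ

/-- The observability Gramian
`W^o(t) = ∫₀ᵗ Φ_A(s,0)ᵀ C(s)ᵀ C(s) Φ_A(s,0) ds` of the signal `σ = (A, B, C)`. -/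
def obsGramian {n m p : ℕ} (σ : ℝ → Triple n m p) (t : ℝ) : Matrix (Fin n) (Fin n) ℝ :=
  ∫ s in (0 : ℝ)..t,
    (flow (fun r => (σ r).1) s 0)ᵀ * (σ s).2.2ᵀ * (σ s).2.2 * flow (fun r => (σ r).1) s 0

/-! ### The assumptions on the switching class -/

/-- Analytic propagation for a family `F = ⋃ F_t` of signals with values in the set of matrices
`M`: the flow of each piecewise constant signal is approached by the endpoint `λ = 1` of a path
of signals along which the flow is analytic and which lies in `F` for a set of parameters with
nonempty interior. -/
def AnalyticPropagation {n : ℕ} (M : Set (Matrix (Fin n) (Fin n) ℝ))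
    (F : ℝ → Set (ℝ → Matrix (Fin n) (Fin n) ℝ)) : Prop :=
  ∀ t > 0, ∀ ε > 0, ∀ A ∈ pcSignals M t,
    ∃ (tl : ℝ → ℝ) (Al : ℝ → ℝ → Matrix (Fin n) (Fin n) ℝ),
      (∀ l ∈ Ioc (0 : ℝ) 1, 0 < tl l ∧ Al l ∈ arbSignals M (tl l)) ∧
      AnalyticOn ℝ (fun l => flow (Al l) (tl l) 0) (Ioc 0 1) ∧
      ‖flow (Al 1) (tl 1) 0 - flow A t 0‖ ≤ ε ∧
      (interior {l ∈ Ioc (0 : ℝ) 1 | Al l ∈ F (tl l)}).Nonempty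

/-- Assumption T2 on a family `G = ⋃ G_t` of signals with values in the set `M` of triples of
matrices: analytic propagation for `G_A`, and the analogue of it for the pair of Gramians. -/
structure AssumptionT2 {n m p : ℕ} (M : Set (Triple n m p))
    (G : ℝ → Set (ℝ → Triple n m p)) : Prop where
  propagation : AnalyticPropagation (Prod.fst '' M) (familyA G)
  gramians : ∀ t > 0, ∀ ε > 0, ∀ σ ∈ pcSignals M t,
    ∃ (tl : ℝ → ℝ) (σl : ℝ → ℝ → Triple n m p),
      (∀ l ∈ Icc (0 : ℝ) 1, 0 < tl l ∧ σl l ∈ arbSignals M (tl l)) ∧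
      AnalyticOn ℝ (fun l => (ctrlGramian (σl l) (tl l), obsGramian (σl l) (tl l))) (Icc 0 1) ∧
      ‖ctrlGramian (σl 1) (tl 1) - ctrlGramian σ t‖ ≤ ε ∧
      ‖obsGramian (σl 1) (tl 1) - obsGramian σ t‖ ≤ ε ∧
      (interior {l ∈ Icc (0 : ℝ) 1 | σl l ∈ G (tl l)}).Nonempty

/-! ### Reachability -/

/-- `x` is on `[0, t]` the (Carathéodory) trajectory of `x' = A x + B u` starting at `0`. -/
structure IsTrajectoryFromZero {n m p : ℕ} (σ : ℝ → Triple n m p) (u : ℝ → Fin m → ℝ) (t : ℝ)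
    (x : ℝ → Fin n → ℝ) : Prop where
  continuousOn : ContinuousOn x (Icc 0 t)
  eq_integral : ∀ r ∈ Icc 0 t, x r = ∫ s in (0 : ℝ)..r, ((σ s).1 *ᵥ x s + (σ s).2.1 *ᵥ u s)

/-- The set of `G`-reachable points: those reached from `0` in some time `t ≥ 0` along some
switching law in `G_t` and some input `u ∈ L₂([0, ∞), ℝᵐ)`. -/
def reachableSet {n m p : ℕ} (G : ℝ → Set (ℝ → Triple n m p)) : Set (Fin n → ℝ) :=
  {z | ∃ t ≥ 0, ∃ σ ∈ G t, ∃ u : ℝ → Fin m → ℝ, MemLp u 2 (volume.restrict (Ici 0)) ∧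
    ∃ x : ℝ → Fin n → ℝ, IsTrajectoryFromZero σ u t x ∧ x t = z}

/-- The subspaces `V_{k+1}(M)`, `k = 0, 1, 2, …`:
`V_1(M) = span {A^j b_l | 0 ≤ j ≤ n-1, 1 ≤ l ≤ m, (A, [b_1 … b_m], C) ∈ M}` and
`V_{k+1}(M) = span {A^j v | 0 ≤ j ≤ n-1, (A, B, C) ∈ M, v ∈ V_k(M)}`. -/
def reachSeq {n m p : ℕ} (M : Set (Triple n m p)) : ℕ → Submodule ℝ (Fin n → ℝ)
  | 0 => Submodule.span ℝ
      {w | ∃ σ ∈ M, ∃ j < n, ∃ l : Fin m, w = (σ.1 ^ j) *ᵥ (fun i => σ.2.1 i l)}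
  | k + 1 => Submodule.span ℝ
      {w | ∃ σ ∈ M, ∃ j < n, ∃ v ∈ reachSeq M k, w = (σ.1 ^ j) *ᵥ v}

/-- The subspace `V(M) = ∑_{j ≥ 1} V_j(M)`. -/
def reachSubspace {n m p : ℕ} (M : Set (Triple n m p)) : Submodule ℝ (Fin n → ℝ) :=
  ⨆ k, reachSeq M k

end SwitchedSystem

end

/-! Write $V$ for `reachSubspace M` and $N(s)=\Phi_A(0,s)B(s)$, so that $W^c=\int NN^T$. The
subspace $V$ is invariant under every $A$ and contains the range of every $B$. With $P$ a projection
whose kernel is $V$, this reads $PA=PAP$ and $PB=0$. Hence $Px$, for a trajectory $x$ from $0$,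
solves a homogeneous linear Volterra equation and vanishes, so trajectories from $0$ stay in $V$
(`trajectory_mem_reachSubspace`). In the same way flows preserve $V$ and Gramians have range in $V$.

For the converse, the control $N^Ty$ steers $0$ to $\Phi_A(t,0)W^c(t)y$ (`exists_trajectory`). Since
the flow is invertible and preserves $V$, one signal of $\mathcal G$ whose Gramian has range $V$
suffices to reach all of $V$.

Such a signal is found in two stages. Among piecewise constant signals, take one minimizing
$\dim\ker W^c$. Concatenating another signal cannot shrink this kernel $K$, which forces
$K\subset\ker W^c_\tau$ for every piecewise constant $\tau$. Constant pieces then give $B^TK=0$ and,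
by differentiating $e^{-hA^T}$ at $h=0$, $A^TK\subset K$, so $K\perp V$
(`exists_pcSignals_ker_orthogonal`). Next, $\det(W^c+P)\neq0$ for this signal, hence also at the
endpoint of the path given by Assumption T2. This determinant is analytic along the path, so it is
nonzero at some parameter whose signal is in $\mathcal G$ (`exists_mem_range_ctrlGramian_eq`). -/

noncomputable section

namespace SwitchedSystem

/-! ### Linear Volterra equations -/

section Volterra

variable {E : Type*} [NormedAddCommGroup E]

/-- `L` is measurable and essentially bounded on `[a, b]`. -/
def EssBddOn {E : Type*} [NormedAddCommGroup E] (L : ℝ → E) (a b : ℝ) : Prop :=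
  AEStronglyMeasurable L (volume.restrict (Icc a b)) ∧
    ∃ C : ℝ, ∀ᵐ s ∂(volume.restrict (Icc a b)), ‖L s‖ ≤ C

theorem EssBddOn.mono {L : ℝ → E} {a b c d : ℝ} (h : EssBddOn L a b)
    (hs : Icc c d ⊆ Icc a b) : EssBddOn L c d :=
  ⟨h.1.mono_measure (Measure.restrict_mono hs le_rfl),
    h.2.imp fun _ hC => ae_restrict_of_ae_restrict_of_subset hs hC⟩

theorem EssBddOn.integrableOn {L : ℝ → E} {a b : ℝ} (h : EssBddOn L a b) :
    IntegrableOn L (Icc a b) := by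
  obtain ⟨hm, C, hC⟩ := h
  exact Integrable.of_bound hm C hC

theorem EssBddOn.intervalIntegrable {L : ℝ → E} {a b s r : ℝ} (h : EssBddOn L a b)
    (hs : s ∈ Icc a b) (hr : r ∈ Icc a b) : IntervalIntegrable L volume s r :=
  (h.integrableOn.mono_set (uIcc_subset_Icc hs hr)).intervalIntegrable

theorem essBddOn_of_continuousOn {L : ℝ → E} {a b : ℝ} (h : ContinuousOn L (Icc a b)) :
    EssBddOn L a b := by
  refine ⟨h.aestronglyMeasurable measurableSet_Icc, ?_⟩
  obtain ⟨C, hC⟩ := isCompact_Icc.exists_bound_of_continuousOn h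
  exact ⟨C, (ae_restrict_mem measurableSet_Icc).mono hC⟩

variable [NormedSpace ℝ E]

/-- Bilinear combinations of essentially bounded functions are essentially bounded. -/
theorem EssBddOn.bilin {F H : Type*} [NormedAddCommGroup F] [NormedSpace ℝ F]
    [NormedAddCommGroup H] [NormedSpace ℝ H] (B : E →L[ℝ] F →L[ℝ] H)
    {f : ℝ → E} {g : ℝ → F} {a b : ℝ} (hf : EssBddOn f a b) (hg : EssBddOn g a b) :
    EssBddOn (fun s => B (f s) (g s)) a b := by
  obtain ⟨hf, C, hC⟩ := hf
  obtain ⟨hg, D, hD⟩ := hg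
  refine ⟨B.aestronglyMeasurable_comp₂ hf hg, ‖B‖ * C * D, ?_⟩
  filter_upwards [hC, hD] with s h1 h2
  refine (B.le_opNorm₂ _ _).trans ?_
  have : 0 ≤ C := (norm_nonneg _).trans h1
  gcongr

theorem EssBddOn.clm {F : Type*} [NormedAddCommGroup F] [NormedSpace ℝ F]
    (B : E →L[ℝ] F) {f : ℝ → E} {a b : ℝ} (hf : EssBddOn f a b) :
    EssBddOn (fun s => B (f s)) a b := by
  obtain ⟨hf, C, hC⟩ := hf
  refine ⟨B.continuous.comp_aestronglyMeasurable hf, ‖B‖ * C, ?_⟩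
  filter_upwards [hC] with s h1
  exact B.le_opNorm_of_le h1

theorem continuousOn_integral_of_integrableOn {g : ℝ → E} {a b s : ℝ}
    (hg : IntegrableOn g (Icc a b)) (hs : s ∈ Icc a b) :
    ContinuousOn (fun r => ∫ τ in s..r, g τ) (Icc a b) := by
  have hab : a ≤ b := hs.1.trans hs.2
  have := intervalIntegral.continuousOn_primitive_interval' (a := s) (b₁ := a) (b₂ := b)
    (μ := volume) (f := g) (by rw [← uIcc_of_le hab] at hg; exact hg.intervalIntegrable)
    (by rwa [uIcc_of_le hab])
  rwa [uIcc_of_le hab] at this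

variable {L : ℝ → E →L[ℝ] E} {a b s : ℝ}

theorem EssBddOn.apply_continuousOn (hL : EssBddOn L a b) {f : ℝ → E}
    (hf : ContinuousOn f (Icc a b)) : EssBddOn (fun τ => L τ (f τ)) a b :=
  EssBddOn.bilin (ContinuousLinearMap.id ℝ (E →L[ℝ] E)) hL (essBddOn_of_continuousOn hf)

/-- The Picard operator of the equation `f r = g r + ∫ τ in s..r, L τ (f τ)`. -/
def picardMap (hL : EssBddOn L a b) (hs : s ∈ Icc a b) (g f : C(Icc a b, E)) : C(Icc a b, E) where
  toFun r := g r + ∫ τ in s..r, L τ (f (projIcc a b (hs.1.trans hs.2) τ))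
  continuous_toFun := by
    refine g.continuous.add ?_
    have h := continuousOn_integral_of_integrableOn (hL.apply_continuousOn
      (f := fun τ => f (projIcc a b (hs.1.trans hs.2) τ))
      (f.continuous.comp continuous_projIcc).continuousOn).integrableOn hs
    exact continuousOn_iff_continuous_domRestrict.mp h

/-- The factorial makes some iterate of the Picard operator a contraction on the whole interval,
with no smallness of `b - a`. The base point `s` is arbitrary in `[a, b]`, so equations are solved
forwards and backwards at once. -/
theorem norm_picardMap_iterate_sub_le (hL : EssBddOn L a b) (hs : s ∈ Icc a b)
    {C : ℝ} (hC : ∀ᵐ τ ∂(volume.restrict (Icc a b)), ‖L τ‖ ≤ C) (hC0 : 0 ≤ C)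
    (g f h : C(Icc a b, E)) (k : ℕ) (r : Icc a b) :
    ‖(picardMap hL hs g)^[k] f r - (picardMap hL hs g)^[k] h r‖ ≤
      (C * |(r : ℝ) - s|) ^ k / k.factorial * dist f h := by
  induction k generalizing r with
  | zero => simpa [dist_eq_norm] using (f - h).norm_coe_le_norm r
  | succ k ih =>
    have hab := hs.1.trans hs.2
    rw [Function.iterate_succ_apply', Function.iterate_succ_apply']
    set f' := (picardMap hL hs g)^[k] f
    set h' := (picardMap hL hs g)^[k] h
    have hint : ∀ q : C(Icc a b, E),
        IntervalIntegrable (fun τ => L τ (q (projIcc a b hab τ))) volume s r := fun q =>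
      (hL.apply_continuousOn (q.continuous.comp continuous_projIcc).continuousOn).intervalIntegrable
        hs r.2
    have hsub : uIoc s (r : ℝ) ⊆ Icc a b := uIoc_subset_uIcc.trans (uIcc_subset_Icc hs r.2)
    change ‖(g r + _) - (g r + _)‖ ≤ _
    rw [add_sub_add_left_eq_sub, ← intervalIntegral.integral_sub (hint _) (hint _),
      intervalIntegral.norm_intervalIntegral_eq]
    calc _ ≤ ∫ τ in uIoc s (r : ℝ), C ^ (k + 1) / k.factorial * dist f h * |τ - s| ^ k := by
          apply norm_integral_le_of_norm_le (Continuous.integrableOn_uIoc (by fun_prop))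
          filter_upwards [ae_restrict_of_ae_restrict_of_subset hsub hC,
            ae_restrict_mem measurableSet_uIoc] with τ h1 h2
          rw [← map_sub, projIcc_of_mem hab (hsub h2)]
          refine ((L τ).le_of_opNorm_le h1 _).trans ((mul_le_mul_of_nonneg_left
            (ih ⟨τ, hsub h2⟩) hC0).trans (le_of_eq ?_))
          simp only [mul_pow]
          ring
      _ = _ := by
          rw [integral_const_mul, integral_pow_abs_sub_uIoc, Nat.factorial_succ]
          push_cast
          rw [mul_pow]
          field_simp

theorem exists_contractingWith_picardMap_iterate (hL : EssBddOn L a b) (hs : s ∈ Icc a b)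
    (g : C(Icc a b, E)) : ∃ (k : ℕ) (K : NNReal), ContractingWith K (picardMap hL hs g)^[k] := by
  obtain ⟨C, hC⟩ := hL.2
  have hC' : ∀ᵐ τ ∂(volume.restrict (Icc a b)), ‖L τ‖ ≤ max C 0 :=
    hC.mono fun τ h => h.trans (le_max_left _ _)
  have hab : 0 ≤ b - a := sub_nonneg.2 (hs.1.trans hs.2)
  obtain ⟨k, hk⟩ := FloorSemiring.tendsto_pow_div_factorial_atTop (max C 0 * (b - a))
    |>.eventually (gt_mem_nhds zero_lt_one) |>.exists
  have h0 : 0 ≤ (max C 0 * (b - a)) ^ k / k.factorial := by positivity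
  refine ⟨k, ⟨_, h0⟩, hk, LipschitzWith.of_dist_le_mul fun f h => ?_⟩
  rw [ContinuousMap.dist_le (by positivity)]
  intro r
  rw [dist_eq_norm]
  refine (norm_picardMap_iterate_sub_le hL hs hC' (le_max_right _ _) g f h k r).trans ?_
  change _ ≤ (max C 0 * (b - a)) ^ k / k.factorial * dist f h
  have : |(r : ℝ) - s| ≤ b - a := by
    rw [abs_le]; constructor <;> linarith [r.2.1, r.2.2, hs.1, hs.2]
  gcongr

theorem exists_volterra [CompleteSpace E] (hL : EssBddOn L a b) (hs : s ∈ Icc a b) {g : ℝ → E}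
    (hg : ContinuousOn g (Icc a b)) :
    ∃ f : ℝ → E, ContinuousOn f (Icc a b) ∧
      ∀ r ∈ Icc a b, f r = g r + ∫ τ in s..r, L τ (f τ) := by
  have hab := hs.1.trans hs.2
  let g' : C(Icc a b, E) := ⟨(Icc a b).domRestrict g, hg.domRestrict⟩
  obtain ⟨k, K, hK⟩ := exists_contractingWith_picardMap_iterate hL hs g'
  have hne : Nonempty C(Icc a b, E) := ⟨0⟩
  have hfix := hK.isFixedPt_fixedPoint_iterate
  set f := ContractingWith.fixedPoint _ hK
  refine ⟨fun τ => f (projIcc a b hab τ),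
    (f.continuous.comp continuous_projIcc).continuousOn, fun r hr => ?_⟩
  have h := DFunLike.congr_fun hfix ⟨r, hr⟩
  simp only [projIcc_of_mem hab hr]
  exact h.symm

theorem volterra_unique (hL : EssBddOn L a b) (hs : s ∈ Icc a b) {f h g : ℝ → E}
    (hf : ContinuousOn f (Icc a b)) (hh : ContinuousOn h (Icc a b))
    (hfe : ∀ r ∈ Icc a b, f r = g r + ∫ τ in s..r, L τ (f τ))
    (hhe : ∀ r ∈ Icc a b, h r = g r + ∫ τ in s..r, L τ (h τ)) : EqOn f h (Icc a b) := by
  -- Continuity of `g` is not assumed; it follows from the equation.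
  have hab := hs.1.trans hs.2
  have hg : ContinuousOn g (Icc a b) := by
    refine (hf.sub (continuousOn_integral_of_integrableOn
      (hL.apply_continuousOn hf).integrableOn hs)).congr fun r hr => ?_
    simp [hfe r hr]
  let g' : C(Icc a b, E) := ⟨(Icc a b).domRestrict g, hg.domRestrict⟩
  obtain ⟨k, K, hK⟩ := exists_contractingWith_picardMap_iterate hL hs g'
  have key : ∀ f : ℝ → E, (hf : ContinuousOn f (Icc a b)) →
      (∀ r ∈ Icc a b, f r = g r + ∫ τ in s..r, L τ (f τ)) →
      Function.IsFixedPt (picardMap hL hs g') ⟨(Icc a b).domRestrict f, hf.domRestrict⟩ := by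
    intro f hf hfe
    ext r
    refine Eq.trans ?_ (hfe r r.2).symm
    change g r + _ = g r + _
    congr 1
    refine intervalIntegral.integral_congr fun τ hτ => ?_
    have : τ ∈ Icc a b := uIcc_subset_Icc hs r.2 hτ
    change L τ (f (projIcc a b hab τ)) = _
    rw [projIcc_of_mem hab this]
  have h1 := (key f hf hfe).iterate k
  have h2 := (key h hh hhe).iterate k
  rcases hK.eq_or_edist_eq_top_of_fixedPoints h1 h2 with h | h
  · exact fun r hr => DFunLike.congr_fun h ⟨r, hr⟩
  · exact absurd h (edist_ne_top _ _)

theorem volterra_eq_zero (hL : EssBddOn L a b) (hs : s ∈ Icc a b) {f : ℝ → E}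
    (hf : ContinuousOn f (Icc a b)) (hfe : ∀ r ∈ Icc a b, f r = ∫ τ in s..r, L τ (f τ)) :
    ∀ r ∈ Icc a b, f r = 0 :=
  volterra_unique (g := 0) hL hs hf continuousOn_const (by simpa using hfe) (by simp)

end Volterra

/-! ### The flow of a measurable essentially bounded signal -/

section Flow

variable {n : ℕ} {A : ℝ → Matrix (Fin n) (Fin n) ℝ} {a b : ℝ}

theorem EssBddOn.matrix_mul {k l m : ℕ} {F : ℝ → Matrix (Fin k) (Fin l) ℝ}
    {H : ℝ → Matrix (Fin l) (Fin m) ℝ} (hF : EssBddOn F a b) (hH : EssBddOn H a b) :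
    EssBddOn (fun s => F s * H s) a b := by
  obtain ⟨hF, C, hC⟩ := hF
  obtain ⟨hH, D, hD⟩ := hH
  refine ⟨?_, C * D, ?_⟩
  · exact (Continuous.matrix_mul continuous_fst continuous_snd).comp_aestronglyMeasurable
      (hF.prodMk hH)
  filter_upwards [hC, hD] with s h1 h2
  refine (Matrix.l2_opNorm_mul _ _).trans ?_
  have : 0 ≤ C := (norm_nonneg _).trans h1
  gcongr

theorem EssBddOn.leftMul (hA : EssBddOn A a b) :
    EssBddOn (fun s => ContinuousLinearMap.mul ℝ (Matrix (Fin n) (Fin n) ℝ) (A s)) a b :=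
  hA.clm _

theorem eq_of_integral_eq (hA : EssBddOn A a b) {s : ℝ} (hs : s ∈ Icc a b)
    {Φ Ψ : ℝ → Matrix (Fin n) (Fin n) ℝ} {Y : Matrix (Fin n) (Fin n) ℝ}
    (hΦ : ContinuousOn Φ (Icc a b)) (hΨ : ContinuousOn Ψ (Icc a b))
    (hΦe : ∀ r ∈ Icc a b, Φ r = Y + ∫ τ in s..r, A τ * Φ τ)
    (hΨe : ∀ r ∈ Icc a b, Ψ r = Y + ∫ τ in s..r, A τ * Ψ τ) : EqOn Φ Ψ (Icc a b) :=
  volterra_unique (g := fun _ => Y) hA.leftMul hs hΦ hΨ hΦe hΨe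

/-- `flow A t s` comes from a choice made separately for each pair `(t, s)`. Uniqueness identifies
all these choices with the values of a single solution on `[a, b]`. -/
theorem flow_eq_of_integral_eq (hA : EssBddOn A a b) {s t : ℝ} (hs : s ∈ Icc a b)
    (ht : t ∈ Icc a b) {Φ : ℝ → Matrix (Fin n) (Fin n) ℝ} (hΦ : ContinuousOn Φ (Icc a b))
    (hΦe : ∀ r ∈ Icc a b, Φ r = 1 + ∫ τ in s..r, A τ * Φ τ) : flow A t s = Φ t := by
  have hsub : uIcc s t ⊆ Icc a b := uIcc_subset_Icc hs ht
  have hex : ∃ Φ, IsFundamentalSolution A s t Φ :=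
    ⟨Φ, hΦ.mono hsub, fun r hr => hΦe r (hsub hr)⟩
  rw [flow, dif_pos hex]
  have h := hex.choose_spec
  exact eq_of_integral_eq (a := min s t) (b := max s t) (Y := 1) (hA.mono hsub)
    (left_mem_uIcc (a := s) (b := t)) h.continuousOn (hΦ.mono hsub) h.eq_integral
    (fun r hr => hΦe r (hsub hr)) (right_mem_uIcc (a := s) (b := t))

theorem flow_spec (hA : EssBddOn A a b) {s : ℝ} (hs : s ∈ Icc a b) :
    ContinuousOn (fun r => flow A r s) (Icc a b) ∧
      ∀ r ∈ Icc a b, flow A r s = 1 + ∫ τ in s..r, A τ * flow A τ s := by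
  obtain ⟨Φ, hΦ, hΦe⟩ := exists_volterra (g := fun _ => (1 : Matrix (Fin n) (Fin n) ℝ))
    hA.leftMul hs continuousOn_const
  have h : ∀ r ∈ Icc a b, flow A r s = Φ r := fun r hr =>
    flow_eq_of_integral_eq hA hs hr hΦ hΦe
  refine ⟨hΦ.congr h, fun r hr => ?_⟩
  rw [h r hr, hΦe r hr]
  congr 1
  refine intervalIntegral.integral_congr fun τ hτ => ?_
  simp [h τ (uIcc_subset_Icc hs hr hτ)]

theorem flow_continuousOn (hA : EssBddOn A a b) {s : ℝ} (hs : s ∈ Icc a b) :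
    ContinuousOn (fun r => flow A r s) (Icc a b) := (flow_spec hA hs).1

theorem flow_self (hA : EssBddOn A a b) {s : ℝ} (hs : s ∈ Icc a b) : flow A s s = 1 := by
  simpa using (flow_spec hA hs).2 s hs

theorem essBddOn_mul_flow (hA : EssBddOn A a b) {s : ℝ} (hs : s ∈ Icc a b) :
    EssBddOn (fun τ => A τ * flow A τ s) a b :=
  hA.matrix_mul (essBddOn_of_continuousOn (flow_continuousOn hA hs))

/-- As functions of `r`, both sides solve the same equation and take the value `flow A s q` at `r =
s`. -/
theorem flow_mul_flow (hA : EssBddOn A a b) {r s q : ℝ} (hr : r ∈ Icc a b) (hs : s ∈ Icc a b)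
    (hq : q ∈ Icc a b) : flow A r s * flow A s q = flow A r q := by
  obtain ⟨hc, he⟩ := flow_spec hA hs
  obtain ⟨hc', he'⟩ := flow_spec hA hq
  refine eq_of_integral_eq hA hs (Y := flow A s q) (Φ := fun r => flow A r s * flow A s q)
    (Ψ := fun r => flow A r q) (hc.mul continuousOn_const) hc' (fun r hr => ?_) (fun r hr => ?_) hr
  · have h := ((ContinuousLinearMap.mul ℝ (Matrix (Fin n) (Fin n) ℝ)).flip
      (flow A s q)).intervalIntegral_comp_comm
      ((essBddOn_mul_flow hA hs).intervalIntegrable hs hr)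
    simp only [ContinuousLinearMap.flip_apply, ContinuousLinearMap.mul_apply'] at h
    simp only [← mul_assoc]
    rw [h, he r hr, add_mul, one_mul]
  · have hi := essBddOn_mul_flow hA hq
    rw [he' r hr, he' s hs, add_assoc, intervalIntegral.integral_add_adjacent_intervals
      (hi.intervalIntegrable hq hs) (hi.intervalIntegrable hs hr)]

theorem flow_mul_flow_self (hA : EssBddOn A a b) {r s : ℝ} (hr : r ∈ Icc a b)
    (hs : s ∈ Icc a b) : flow A r s * flow A s r = 1 := by
  rw [flow_mul_flow hA hr hs hr, flow_self hA hr]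

theorem flow_eq_inv (hA : EssBddOn A a b) {r s : ℝ} (hr : r ∈ Icc a b)
    (hs : s ∈ Icc a b) : flow A r s = (flow A s r)⁻¹ :=
  (Matrix.inv_eq_left_inv (flow_mul_flow_self hA hr hs)).symm

/-- The controllability Gramian involves the flow as a function of its starting time; continuity
there comes from that of matrix inversion. -/
theorem flow_continuousOn_right (hA : EssBddOn A a b) {r : ℝ} (hr : r ∈ Icc a b) :
    ContinuousOn (fun s => flow A r s) (Icc a b) := by
  have h : ContinuousOn (fun s => (flow A s r)⁻¹) (Icc a b) := by
    intro s hs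
    have hu : IsUnit (flow A s r) := ⟨⟨flow A s r, flow A r s, flow_mul_flow_self hA hs hr,
      flow_mul_flow_self hA hr hs⟩, rfl⟩
    obtain ⟨u, hu⟩ := hu
    have := NormedRing.inverse_continuousAt u
    rw [hu] at this
    simp_rw [Matrix.nonsing_inv_eq_ringInverse]
    exact ContinuousAt.comp_continuousWithinAt (f := fun s => flow A s r) this
      (flow_continuousOn hA hr s hs)
  exact h.congr fun s hs => flow_eq_inv hA hr hs

/-- Agreement is only required on `Ioc a b`: at the junction of a concatenation the value is that of
the first signal. -/
theorem flow_shift {A' : ℝ → Matrix (Fin n) (Fin n) ℝ} {c : ℝ} (hA : EssBddOn A a b)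
    (hA' : EssBddOn A' (a + c) (b + c)) (h : ∀ τ ∈ Ioc a b, A' (τ + c) = A τ) {r q : ℝ}
    (hr : r ∈ Icc a b) (hq : q ∈ Icc a b) : flow A' (r + c) (q + c) = flow A r q := by
  obtain ⟨hc, he⟩ := flow_spec hA hq
  have hsh : ∀ s ∈ Icc (a + c) (b + c), s - c ∈ Icc a b := fun s hs =>
    ⟨by linarith [hs.1], by linarith [hs.2]⟩
  have := flow_eq_of_integral_eq hA' (s := q + c) (t := r + c) (Φ := fun s => flow A (s - c) q)
    ⟨by linarith [hq.1], by linarith [hq.2]⟩ ⟨by linarith [hr.1], by linarith [hr.2]⟩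
    (hc.comp (by fun_prop) hsh) (fun s hs => ?_)
  · simpa using this
  · rw [he _ (hsh s hs)]
    congr 1
    have h1 := intervalIntegral.integral_comp_sub_right (a := q + c) (b := s)
      (fun τ => A τ * flow A τ q) c
    rw [add_sub_cancel_right] at h1
    rw [← h1]
    refine intervalIntegral.integral_congr_ae (ae_of_all _ fun τ hτ => ?_)
    have h2 : τ - c ∈ Ioc a b := by
      rcases le_total (q + c) s with hqs | hqs
      · rw [uIoc_of_le hqs] at hτ
        exact ⟨by linarith [hτ.1, hq.1], by linarith [hτ.2, (hsh s hs).2]⟩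
      · rw [uIoc_of_ge hqs] at hτ
        exact ⟨by linarith [hτ.1, (hsh s hs).1], by linarith [hτ.2, hq.2]⟩
    rw [← h _ h2, sub_add_cancel]

theorem flow_const (A : Matrix (Fin n) (Fin n) ℝ) (t : ℝ) (ht : 0 ≤ t) :
    flow (fun _ => A) 0 t = NormedSpace.exp ((-t) • A) := by
  have hA : EssBddOn (fun _ : ℝ => A) 0 t := essBddOn_of_continuousOn continuousOn_const
  have hd : ∀ r : ℝ, HasDerivAt (fun u : ℝ => NormedSpace.exp ((u - t) • A))
      (A * NormedSpace.exp ((r - t) • A)) r := fun r =>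
    (hasDerivAt_exp_smul_const' A (r - t)).comp_sub_const r t
  have hc : Continuous (fun u : ℝ => NormedSpace.exp ((u - t) • A)) :=
    continuous_iff_continuousAt.2 fun r => (hd r).continuousAt
  rw [flow_eq_of_integral_eq hA (right_mem_Icc.2 ht) (left_mem_Icc.2 ht) hc.continuousOn
    (fun r _ => ?_), zero_sub]
  rw [intervalIntegral.integral_eq_sub_of_hasDerivAt (fun r _ => hd r)
    ((continuous_const.mul hc).intervalIntegrable _ _)]
  simp

end Flow

/-! ### The reachable subspace -/

section Subspace

variable {n m p : ℕ} {M : Set (Triple n m p)}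

theorem mulVec_mem_reachSubspace {σ : Triple n m p} (hσ : σ ∈ M) {v : Fin n → ℝ}
    (hv : v ∈ reachSubspace M) : σ.1 *ᵥ v ∈ reachSubspace M := by
  have h : reachSubspace M ≤ (reachSubspace M).comap (Matrix.mulVecLin σ.1) := by
    refine iSup_le fun k v hv => ?_
    rw [Submodule.mem_comap, Matrix.mulVecLin_apply]
    -- The exponent `j = 1` is available only when `1 < n`. For `n = 1` matrices act as scalars, and
    -- for `n = 0` there is nothing to prove.
    rcases lt_or_ge 1 n with hn | hn
    · exact Submodule.mem_iSup_of_mem (k + 1)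
        (Submodule.subset_span ⟨σ, hσ, 1, hn, v, hv, by rw [pow_one]⟩)
    · have hs : Subsingleton (Fin n) := Fin.subsingleton_iff_le_one.2 hn
      refine Submodule.mem_iSup_of_mem k ?_
      rcases isEmpty_or_nonempty (Fin n) with he | ⟨⟨i⟩⟩
      · rw [Subsingleton.elim (σ.1 *ᵥ v) 0]
        exact Submodule.zero_mem _
      · have : σ.1 *ᵥ v = σ.1 i i • v := by
          have hu : (Finset.univ : Finset (Fin n)) = {i} :=
            Finset.eq_singleton_iff_unique_mem.2 ⟨Finset.mem_univ i, fun j _ => hs.elim j i⟩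
          ext j
          simp [Matrix.mulVec, dotProduct, hu, hs.elim j i]
        rw [this]
        exact Submodule.smul_mem _ _ hv
  exact h hv

theorem input_mulVec_mem_reachSubspace {σ : Triple n m p} (hσ : σ ∈ M) (u : Fin m → ℝ) :
    σ.2.1 *ᵥ u ∈ reachSubspace M := by
  rcases Nat.eq_zero_or_pos n with rfl | hn
  · rw [Subsingleton.elim (σ.2.1 *ᵥ u) 0]
    exact Submodule.zero_mem _
  have h : σ.2.1 *ᵥ u = ∑ l, u l • (fun i => σ.2.1 i l) := by
    ext i
    simp [Matrix.mulVec, dotProduct, mul_comm]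
  rw [h]
  refine Submodule.sum_mem _ fun l _ => Submodule.smul_mem _ _ ?_
  exact Submodule.mem_iSup_of_mem 0
    (Submodule.subset_span ⟨σ, hσ, 0, hn, l, by rw [pow_zero, Matrix.one_mulVec]⟩)

/-- Vectors annihilated by every `Bᵀ` and belonging to a common `Aᵀ`-invariant subspace are
orthogonal to the reachable subspace. -/
theorem dotProduct_eq_zero_of_mem_reachSubspace {K : Submodule ℝ (Fin n → ℝ)}
    (hA : ∀ σ ∈ M, ∀ w ∈ K, σ.1ᵀ *ᵥ w ∈ K) (hB : ∀ σ ∈ M, ∀ w ∈ K, σ.2.1ᵀ *ᵥ w = 0)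
    {w v : Fin n → ℝ} (hw : w ∈ K) (hv : v ∈ reachSubspace M) : w ⬝ᵥ v = 0 := by
  have hpow : ∀ σ ∈ M, ∀ (j : ℕ), ∀ w ∈ K, (σ.1 ^ j)ᵀ *ᵥ w ∈ K := by
    intro σ hσ j
    induction j with
    | zero => intro w hw; simpa using hw
    | succ j ih =>
      intro w hw
      rw [pow_succ, Matrix.transpose_mul, ← Matrix.mulVec_mulVec]
      exact hA σ hσ _ (ih w hw)
  -- The orthogonal complement of `K`, built from the dot product because `Fin n → ℝ` carries the
  -- sup norm.
  let D : Submodule ℝ (Fin n → ℝ) := ⨅ w : K, LinearMap.ker (dotProductBilin ℝ ℝ (w : Fin n → ℝ))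
  have hD : ∀ v, v ∈ D ↔ ∀ w ∈ K, w ⬝ᵥ v = 0 := by
    intro v
    simp [D, Submodule.mem_iInf]
  have hadj : ∀ (X : Matrix (Fin n) (Fin n) ℝ) (w v : Fin n → ℝ),
      w ⬝ᵥ (X *ᵥ v) = (Xᵀ *ᵥ w) ⬝ᵥ v := by
    intro X w v
    rw [Matrix.dotProduct_mulVec, Matrix.mulVec_transpose]
  have key : ∀ k, reachSeq M k ≤ D := by
    intro k
    induction k with
    | zero =>
      refine Submodule.span_le.2 ?_
      rintro _ ⟨σ, hσ, j, -, l, rfl⟩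
      refine (hD _).2 fun w hw => ?_
      rw [hadj]
      have := congrFun (hB σ hσ _ (hpow σ hσ j w hw)) l
      rw [dotProduct_comm]
      exact this
    | succ k ih =>
      refine Submodule.span_le.2 ?_
      rintro _ ⟨σ, hσ, j, -, v, hv, rfl⟩
      refine (hD _).2 fun w hw => ?_
      rw [hadj]
      exact (hD v).1 (ih hv) _ (hpow σ hσ j w hw)
  exact (hD v).1 ((iSup_le key : reachSubspace M ≤ D) hv) w hw

/-- Turns membership in `V` into a linear equation, which passes through integrals. Any complement
of `V` will do. -/
theorem exists_projection_with_ker (V : Submodule ℝ (Fin n → ℝ)) :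
    ∃ P : Matrix (Fin n) (Fin n) ℝ, P * P = P ∧ ∀ v, P *ᵥ v = 0 ↔ v ∈ V := by
  obtain ⟨U, hU⟩ := V.exists_isCompl
  refine ⟨LinearMap.toMatrix' (U.projection V hU.symm), ?_, fun v => ?_⟩
  · rw [← LinearMap.toMatrix'_mul, (Submodule.isIdempotentElem_projection hU.symm).eq]
  · rw [LinearMap.toMatrix'_mulVec, Submodule.projection_apply_eq_zero_iff]

variable {P : Matrix (Fin n) (Fin n) ℝ}

theorem projection_mul_eq (hP : P * P = P) (hPV : ∀ v, P *ᵥ v = 0 ↔ v ∈ reachSubspace M)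
    {σ : Triple n m p} (hσ : σ ∈ M) : P * σ.1 = P * σ.1 * P := by
  have : P * σ.1 * (1 - P) = 0 := by
    refine Matrix.toLin'.injective (LinearMap.ext fun v => ?_)
    rw [Matrix.toLin'_apply, map_zero, LinearMap.zero_apply, ← Matrix.mulVec_mulVec,
      ← Matrix.mulVec_mulVec, hPV]
    refine mulVec_mem_reachSubspace hσ ((hPV _).1 ?_)
    rw [Matrix.mulVec_mulVec, mul_sub, mul_one, hP, sub_self, Matrix.zero_mulVec]
  rwa [mul_sub, mul_one, sub_eq_zero] at this

theorem projection_mul_input_eq_zero (hPV : ∀ v, P *ᵥ v = 0 ↔ v ∈ reachSubspace M)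
    {σ : Triple n m p} (hσ : σ ∈ M) : P * σ.2.1 = 0 := by
  refine Matrix.toLin'.injective (LinearMap.ext fun v => ?_)
  rw [Matrix.toLin'_apply, map_zero, LinearMap.zero_apply, ← Matrix.mulVec_mulVec, hPV]
  exact input_mulVec_mem_reachSubspace hσ v

end Subspace

/-! ### Gramians and trajectories of measurable signals -/

section Signals

variable {n m p : ℕ} {M : Set (Triple n m p)} {t : ℝ} {σ : ℝ → Triple n m p}

/-- Multiplication of vectors by matrices as a continuous bilinear map. -/
def mulVecL (k l : ℕ) : Matrix (Fin k) (Fin l) ℝ →L[ℝ] (Fin l → ℝ) →L[ℝ] (Fin k → ℝ) :=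
  LinearMap.toContinuousLinearMap
    ((LinearMap.toContinuousLinearMap (𝕜 := ℝ) (E := Fin l → ℝ) (F' := Fin k → ℝ)).toLinearMap ∘ₗ
      (Matrix.toLin' (R := ℝ) (m := Fin k) (n := Fin l)).toLinearMap)

@[simp]
theorem mulVecL_apply {k l : ℕ} (X : Matrix (Fin k) (Fin l) ℝ) (v : Fin l → ℝ) :
    mulVecL k l X v = X *ᵥ v := rfl

/-- Transposition as a continuous linear map. -/
def transposeL (k l : ℕ) : Matrix (Fin k) (Fin l) ℝ →L[ℝ] Matrix (Fin l) (Fin k) ℝ :=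
  LinearMap.toContinuousLinearMap (Matrix.transposeLinearEquiv (Fin k) (Fin l) ℝ ℝ).toLinearMap

@[simp]
theorem transposeL_apply {k l : ℕ} (X : Matrix (Fin k) (Fin l) ℝ) : transposeL k l X = Xᵀ := rfl

theorem essBddOn_of_mem_arbSignals (hMb : Bornology.IsBounded M) (hσ : σ ∈ arbSignals M t) :
    EssBddOn σ 0 t := by
  obtain ⟨C, hC⟩ := hMb.exists_norm_le
  exact ⟨hσ.1, C, hσ.2.mono fun s hs => hC _ hs⟩

theorem EssBddOn.fst_signal (hσ : EssBddOn σ 0 t) : EssBddOn (fun s => (σ s).1) 0 t :=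
  hσ.clm (ContinuousLinearMap.fst ℝ _ _)

theorem EssBddOn.input_signal (hσ : EssBddOn σ 0 t) : EssBddOn (fun s => (σ s).2.1) 0 t :=
  (hσ.clm (ContinuousLinearMap.snd ℝ _ _)).clm (ContinuousLinearMap.fst ℝ _ _)

/-- The matrix `Φ_A(0, s) B(s)` entering the controllability Gramian. -/
def inputKernel (σ : ℝ → Triple n m p) (s : ℝ) : Matrix (Fin n) (Fin m) ℝ :=
  flow (fun r => (σ r).1) 0 s * (σ s).2.1

theorem essBddOn_inputKernel (hσ : EssBddOn σ 0 t) (ht : 0 ≤ t) :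
    EssBddOn (inputKernel σ) 0 t :=
  (essBddOn_of_continuousOn
    (flow_continuousOn_right hσ.fst_signal (left_mem_Icc.2 ht))).matrix_mul hσ.input_signal

theorem ctrlGramian_eq (σ : ℝ → Triple n m p) (t : ℝ) :
    ctrlGramian σ t = ∫ s in (0 : ℝ)..t, inputKernel σ s * (inputKernel σ s)ᵀ := by
  simp only [ctrlGramian, inputKernel, Matrix.transpose_mul, Matrix.mul_assoc]

theorem essBddOn_inputKernel_mul_transpose (hσ : EssBddOn σ 0 t) (ht : 0 ≤ t) :
    EssBddOn (fun s => inputKernel σ s * (inputKernel σ s)ᵀ) 0 t :=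
  (essBddOn_inputKernel hσ ht).matrix_mul ((essBddOn_inputKernel hσ ht).clm (transposeL n m))

theorem ctrlGramian_mulVec (hσ : EssBddOn σ 0 t) (ht : 0 ≤ t) (w : Fin n → ℝ) :
    ctrlGramian σ t *ᵥ w =
      ∫ s in (0 : ℝ)..t, inputKernel σ s *ᵥ ((inputKernel σ s)ᵀ *ᵥ w) := by
  have h := ((mulVecL n n).flip w).intervalIntegral_comp_comm
    ((essBddOn_inputKernel_mul_transpose hσ ht).intervalIntegrable (left_mem_Icc.2 ht)
      (right_mem_Icc.2 ht))
  simp only [ContinuousLinearMap.flip_apply, mulVecL_apply, ← ctrlGramian_eq] at h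
  simp only [Matrix.mulVec_mulVec]
  exact h.symm

theorem dotProduct_ctrlGramian_mulVec (hσ : EssBddOn σ 0 t) (ht : 0 ≤ t) (w : Fin n → ℝ) :
    w ⬝ᵥ (ctrlGramian σ t *ᵥ w) =
      ∫ s in (0 : ℝ)..t, ((inputKernel σ s)ᵀ *ᵥ w) ⬝ᵥ ((inputKernel σ s)ᵀ *ᵥ w) := by
  rw [ctrlGramian_mulVec hσ ht]
  have hi := ((essBddOn_inputKernel_mul_transpose hσ ht).clm
    ((mulVecL n n).flip w)).intervalIntegrable (left_mem_Icc.2 ht) (right_mem_Icc.2 ht)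
  simp only [ContinuousLinearMap.flip_apply, mulVecL_apply, ← Matrix.mulVec_mulVec] at hi
  have h := (LinearMap.toContinuousLinearMap
    (dotProductBilin ℝ ℝ w)).intervalIntegral_comp_comm hi
  simp only [LinearMap.coe_toContinuousLinearMap', dotProductBilin_apply_apply] at h
  rw [← h]
  simp only [Matrix.dotProduct_mulVec, Matrix.mulVec_transpose]

/-- Since $w^TWw=\int|N^Tw|^2$, a vector in the kernel makes a nonnegative integrand vanish almost
everywhere. -/
theorem ctrlGramian_mulVec_eq_zero_iff (hσ : EssBddOn σ 0 t) (ht : 0 ≤ t) (w : Fin n → ℝ) :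
    ctrlGramian σ t *ᵥ w = 0 ↔
      ∀ᵐ s ∂(volume.restrict (Icc 0 t)), (inputKernel σ s)ᵀ *ᵥ w = 0 := by
  constructor
  · intro h
    have h0 := dotProduct_ctrlGramian_mulVec hσ ht w
    rw [h, dotProduct_zero, intervalIntegral.integral_of_le ht, ← integral_Icc_eq_integral_Ioc,
      eq_comm] at h0
    have hb := ((essBddOn_inputKernel hσ ht).clm (transposeL n m)).clm ((mulVecL m n).flip w)
    have hb2 := EssBddOn.bilin (LinearMap.toContinuousLinearMap
      ((LinearMap.toContinuousLinearMap (𝕜 := ℝ) (E := Fin m → ℝ) (F' := ℝ)).toLinearMap ∘ₗ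
        dotProductBilin ℝ ℝ)) hb hb
    have := (integral_eq_zero_iff_of_nonneg
      (f := fun s => ((inputKernel σ s)ᵀ *ᵥ w) ⬝ᵥ ((inputKernel σ s)ᵀ *ᵥ w))
      (fun s => Finset.sum_nonneg fun i _ => mul_self_nonneg _) hb2.integrableOn).1 h0
    filter_upwards [this] with s hs
    exact dotProduct_self_eq_zero.1 hs
  · intro h
    rw [ctrlGramian_mulVec hσ ht, intervalIntegral.integral_of_le ht,
      ← integral_Icc_eq_integral_Ioc]
    refine integral_eq_zero_of_ae ?_
    filter_upwards [h] with s hs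
    simp [hs]

variable {P : Matrix (Fin n) (Fin n) ℝ}

/-- The flow preserves $V$, the range of $1-P$: as $P(1-P)=0$ and $PA=PAP$, the product $P\Phi(1-P)$
solves a homogeneous equation with coefficient $PA$. -/
theorem projection_mul_flow (hP : P * P = P) (hPV : ∀ v, P *ᵥ v = 0 ↔ v ∈ reachSubspace M)
    (hMb : Bornology.IsBounded M) (hσ : σ ∈ arbSignals M t) {r s : ℝ} (hr : r ∈ Icc 0 t)
    (hs : s ∈ Icc 0 t) : P * flow (fun r => (σ r).1) r s * (1 - P) = 0 := by
  have hA := (essBddOn_of_mem_arbSignals hMb hσ).fst_signal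
  obtain ⟨hc, he⟩ := flow_spec hA hs
  have hPA : EssBddOn (fun s => P * (σ s).1) 0 t :=
    (essBddOn_of_continuousOn continuousOn_const).matrix_mul hA
  refine volterra_eq_zero (f := fun r => P * flow (fun r => (σ r).1) r s * (1 - P)) hPA.leftMul hs
    ((continuousOn_const.mul hc).mul continuousOn_const) (fun r hr => ?_) r hr
  have h := (((ContinuousLinearMap.mul ℝ (Matrix (Fin n) (Fin n) ℝ)).flip (1 - P)).comp
      (ContinuousLinearMap.mul ℝ (Matrix (Fin n) (Fin n) ℝ) P)).intervalIntegral_comp_comm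
      ((essBddOn_mul_flow hA hs).intervalIntegrable hs hr)
  simp only [ContinuousLinearMap.comp_apply, ContinuousLinearMap.flip_apply,
    ContinuousLinearMap.mul_apply'] at h
  simp only [he r hr, mul_add, add_mul, mul_one, ← h, ContinuousLinearMap.mul_apply']
  rw [mul_sub, mul_one, hP, sub_self, zero_add]
  have hsub : uIoc s r ⊆ Icc 0 t := uIoc_subset_uIcc.trans (uIcc_subset_Icc hs hr)
  refine intervalIntegral.integral_congr_ae
    ((ae_restrict_iff' measurableSet_uIoc).1 ?_)
  filter_upwards [ae_restrict_of_ae_restrict_of_subset hsub hσ.2] with τ hτ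
  have := projection_mul_eq hP hPV hτ
  calc P * ((σ τ).1 * flow (fun r => (σ r).1) τ s) * (1 - P)
      = (P * (σ τ).1) * flow (fun r => (σ r).1) τ s * (1 - P) := by simp only [mul_assoc]
    _ = _ := by conv_lhs => rw [this]
                simp only [mul_assoc]

theorem projection_mul_inputKernel (hP : P * P = P)
    (hPV : ∀ v, P *ᵥ v = 0 ↔ v ∈ reachSubspace M)
    (hMb : Bornology.IsBounded M) (hσ : σ ∈ arbSignals M t) :
    ∀ᵐ s ∂(volume.restrict (Icc 0 t)), P * inputKernel σ s = 0 := by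
  filter_upwards [hσ.2, ae_restrict_mem measurableSet_Icc] with s hs hst
  have h1 := projection_mul_flow hP hPV hMb hσ (left_mem_Icc.2 (hst.1.trans hst.2)) hst
  have h2 := projection_mul_input_eq_zero hPV hs
  rw [mul_sub, mul_one, sub_eq_zero] at h1
  rw [inputKernel, ← Matrix.mul_assoc, h1, Matrix.mul_assoc, h2, Matrix.mul_zero]

theorem ctrlGramian_mulVec_mem (hMb : Bornology.IsBounded M) (ht : 0 ≤ t)
    (hσ : σ ∈ arbSignals M t) (w : Fin n → ℝ) : ctrlGramian σ t *ᵥ w ∈ reachSubspace M := by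
  obtain ⟨P, hP, hPV⟩ := exists_projection_with_ker (reachSubspace M)
  rw [← hPV]
  have hb := essBddOn_of_mem_arbSignals hMb hσ
  have hi := ((essBddOn_inputKernel_mul_transpose hb ht).clm
    ((mulVecL n n).flip w)).intervalIntegrable (left_mem_Icc.2 ht) (right_mem_Icc.2 ht)
  simp only [ContinuousLinearMap.flip_apply, mulVecL_apply, ← Matrix.mulVec_mulVec] at hi
  have h := (mulVecL n n P).intervalIntegral_comp_comm hi
  rw [ctrlGramian_mulVec hb ht]
  refine h.symm.trans ?_
  rw [intervalIntegral.integral_of_le ht, ← integral_Icc_eq_integral_Ioc]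
  refine integral_eq_zero_of_ae ?_
  filter_upwards [projection_mul_inputKernel hP hPV hMb hσ] with s hs
  rw [mulVecL_apply, Matrix.mulVec_mulVec, hs, Matrix.zero_mulVec, Pi.zero_apply]

theorem trajectory_mem_reachSubspace (hMb : Bornology.IsBounded M) (ht : 0 ≤ t)
    (hσ : σ ∈ arbSignals M t) {u : ℝ → Fin m → ℝ} {x : ℝ → Fin n → ℝ}
    (hx : IsTrajectoryFromZero σ u t x) : x t ∈ reachSubspace M := by
  obtain ⟨P, hP, hPV⟩ := exists_projection_with_ker (reachSubspace M)
  have h0 : (0 : ℝ) ∈ Icc 0 t := left_mem_Icc.2 ht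
  have ht' : t ∈ Icc 0 t := right_mem_Icc.2 ht
  -- Nothing is assumed about `u`. Without integrability the integral takes its default value `0`,
  -- so `x t = 0`.
  by_cases hi : IntervalIntegrable (fun s => (σ s).1 *ᵥ x s + (σ s).2.1 *ᵥ u s) volume 0 t
  swap
  · rw [hx.eq_integral t ht', intervalIntegral.integral_undef hi]
    exact Submodule.zero_mem _
  rw [← hPV]
  have hA := (essBddOn_of_mem_arbSignals hMb hσ).fst_signal
  have hPA : EssBddOn (fun s => P * (σ s).1) 0 t :=
    (essBddOn_of_continuousOn continuousOn_const).matrix_mul hA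
  refine volterra_eq_zero (f := fun r => P *ᵥ x r) (hPA.clm (mulVecL n n)) h0
    ((mulVecL n n P).continuous.comp_continuousOn hx.continuousOn) (fun r hr => ?_) t ht'
  have h := (mulVecL n n P).intervalIntegral_comp_comm
    (hi.mono_set (by rw [uIcc_of_le hr.1, uIcc_of_le ht]; exact Icc_subset_Icc_right hr.2))
  simp only [mulVecL_apply] at h ⊢
  rw [hx.eq_integral r hr, ← h]
  have hsub : uIoc 0 r ⊆ Icc 0 t := uIoc_subset_uIcc.trans (uIcc_subset_Icc h0 hr)
  refine intervalIntegral.integral_congr_ae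
    ((ae_restrict_iff' measurableSet_uIoc).1 ?_)
  filter_upwards [ae_restrict_of_ae_restrict_of_subset hsub hσ.2] with τ hτ
  rw [Matrix.mulVec_add, Matrix.mulVec_mulVec, Matrix.mulVec_mulVec, Matrix.mulVec_mulVec,
    projection_mul_input_eq_zero hPV hτ, Matrix.zero_mulVec, add_zero,
    ← projection_mul_eq hP hPV hτ]

end Signals

/-! ### Variation of constants -/

section VariationOfConstants

/-- The product rule for absolutely continuous functions; coefficients are merely measurable, so
derivatives exist only almost everywhere. -/
theorem integral_primitive_mul_primitive {f g : ℝ → ℝ} {a b c : ℝ}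
    (hf : IntervalIntegrable f volume a b) (hg : IntervalIntegrable g volume a b) :
    (c + ∫ τ in a..b, f τ) * ∫ τ in a..b, g τ =
      ∫ s in a..b, f s * (∫ τ in a..s, g τ) + (c + ∫ τ in a..s, f τ) * g s := by
  have ha : a ∈ uIcc a b := left_mem_uIcc
  have hF : AbsolutelyContinuousOnInterval (fun s => c + ∫ τ in a..s, f τ) a b :=
    AbsolutelyContinuousOnInterval.add (f := fun _ => c)
      (contDiffOn_const (n := 1)).absolutelyContinuousOnInterval
      (hf.absolutelyContinuousOnInterval_intervalIntegral ha)
  have hG := hg.absolutelyContinuousOnInterval_intervalIntegral ha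
  have h := hF.integral_deriv_mul_eq_sub hG
  simp only [intervalIntegral.integral_same, mul_zero, sub_zero] at h
  rw [← h]
  refine intervalIntegral.integral_congr_ae ?_
  filter_upwards [hf.ae_hasDerivAt_integral, hg.ae_hasDerivAt_integral] with s h1 h2 hs
  have hs' := uIoc_subset_uIcc hs
  rw [((h1 hs' a ha).const_add c).deriv, (h2 hs' a ha).deriv]

theorem intervalIntegral_matrix_apply {k l : ℕ} {f : ℝ → Matrix (Fin k) (Fin l) ℝ} {a b : ℝ}
    (hf : IntervalIntegrable f volume a b) (i : Fin k) (j : Fin l) :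
    (∫ s in a..b, f s) i j = ∫ s in a..b, f s i j :=
  ((LinearMap.toContinuousLinearMap
    (Matrix.entryLinearMap ℝ ℝ i j)).intervalIntegral_comp_comm hf).symm

theorem intervalIntegral_pi_apply {k : ℕ} {f : ℝ → Fin k → ℝ} {a b : ℝ}
    (hf : IntervalIntegrable f volume a b) (i : Fin k) :
    (∫ s in a..b, f s) i = ∫ s in a..b, f s i :=
  ((ContinuousLinearMap.proj (R := ℝ) (φ := fun _ : Fin k => ℝ) i).intervalIntegral_comp_comm
    hf).symm

theorem primitive_mulVec_primitive {k l : ℕ} {f : ℝ → Matrix (Fin k) (Fin l) ℝ}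
    {g : ℝ → Fin l → ℝ} {C : Matrix (Fin k) (Fin l) ℝ} {a b : ℝ} (hab : a ≤ b)
    (hf : EssBddOn f a b) (hg : EssBddOn g a b) :
    (C + ∫ τ in a..b, f τ) *ᵥ (∫ τ in a..b, g τ) =
      ∫ s in a..b, f s *ᵥ (∫ τ in a..s, g τ) + (C + ∫ τ in a..s, f τ) *ᵥ g s := by
  have ha : a ∈ Icc a b := left_mem_Icc.2 hab
  have hb : b ∈ Icc a b := right_mem_Icc.2 hab
  have hfc := continuousOn_integral_of_integrableOn hf.integrableOn ha
  have hgc := continuousOn_integral_of_integrableOn hg.integrableOn ha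
  have hfi : ∀ s ∈ Icc a b, ∀ i j, (∫ τ in a..s, f τ) i j = ∫ τ in a..s, f τ i j :=
    fun s hs i j => intervalIntegral_matrix_apply (hf.intervalIntegrable ha hs) i j
  have hgi : ∀ s ∈ Icc a b, ∀ j, (∫ τ in a..s, g τ) j = ∫ τ in a..s, g τ j :=
    fun s hs j => intervalIntegral_pi_apply (hg.intervalIntegrable ha hs) j
  have hfb : ∀ i j, EssBddOn (fun s => f s i j) a b := fun i j =>
    hf.clm (LinearMap.toContinuousLinearMap (Matrix.entryLinearMap ℝ ℝ i j))
  have hgb : ∀ j, EssBddOn (fun s => g s j) a b := fun j =>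
    hg.clm (ContinuousLinearMap.proj (R := ℝ) (φ := fun _ : Fin l => ℝ) j)
  have hI1 := (EssBddOn.bilin (mulVecL k l) hf (essBddOn_of_continuousOn hgc)).intervalIntegrable
    ha hb
  have hI2 := (EssBddOn.bilin (mulVecL k l) (essBddOn_of_continuousOn
    (continuousOn_const (c := C) |>.add hfc)) hg).intervalIntegrable ha hb
  simp only [mulVecL_apply, Pi.add_apply] at hI1 hI2
  ext i
  rw [intervalIntegral_pi_apply (hI1.add hI2)]
  simp only [Pi.add_apply, Matrix.mulVec, dotProduct, Matrix.add_apply, ← Finset.sum_add_distrib]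
  have hterm : ∀ j, IntervalIntegrable (fun s => f s i j * (∫ τ in a..s, g τ j) +
      (C i j + ∫ τ in a..s, f τ i j) * g s j) volume a b := by
    intro j
    have h1 := continuousOn_integral_of_integrableOn (hfb i j).integrableOn ha
    have h2 := continuousOn_integral_of_integrableOn (hgb j).integrableOn ha
    exact ((EssBddOn.bilin (ContinuousLinearMap.mul ℝ ℝ) (hfb i j)
      (essBddOn_of_continuousOn h2)).intervalIntegrable ha hb).add
      ((EssBddOn.bilin (ContinuousLinearMap.mul ℝ ℝ) (essBddOn_of_continuousOn
        (continuousOn_const (c := C i j) |>.add h1)) (hgb j)).intervalIntegrable ha hb)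
  trans ∫ s in a..b, ∑ j, (f s i j * (∫ τ in a..s, g τ j) +
      (C i j + ∫ τ in a..s, f τ i j) * g s j)
  · rw [intervalIntegral.integral_finsetSum fun j _ => hterm j]
    refine Finset.sum_congr rfl fun j _ => ?_
    rw [hfi b hb, hgi b hb]
    exact integral_primitive_mul_primitive ((hfb i j).intervalIntegrable ha hb)
      ((hgb j).intervalIntegrable ha hb)
  · refine intervalIntegral.integral_congr fun s hs => ?_
    rw [uIcc_of_le hab] at hs
    simp only [hfi s hs, hgi s hs]

variable {n m p : ℕ} {M : Set (Triple n m p)} {t : ℝ} {σ : ℝ → Triple n m p}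

/-- The control steering `0` to `Φ(t, 0) W(t) y`. -/
theorem exists_trajectory (hσ : EssBddOn σ 0 t) (ht : 0 ≤ t) (y : Fin n → ℝ) :
    ∃ u : ℝ → Fin m → ℝ, MemLp u 2 (volume.restrict (Ici 0)) ∧
      ∃ x : ℝ → Fin n → ℝ, IsTrajectoryFromZero σ u t x ∧
        x t = flow (fun r => (σ r).1) t 0 *ᵥ (ctrlGramian σ t *ᵥ y) := by
  have h0 : (0 : ℝ) ∈ Icc 0 t := left_mem_Icc.2 ht
  have hA := hσ.fst_signal
  have hN := essBddOn_inputKernel hσ ht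
  have hv := (hN.clm (transposeL n m)).clm ((mulVecL m n).flip y)
  simp only [ContinuousLinearMap.flip_apply, mulVecL_apply, transposeL_apply] at hv
  have hg := EssBddOn.bilin (mulVecL n m) hN hv
  simp only [mulVecL_apply] at hg
  have hgc := continuousOn_integral_of_integrableOn hg.integrableOn h0
  obtain ⟨hc, he⟩ := flow_spec hA h0
  refine ⟨(Icc 0 t).indicator fun s => (inputKernel σ s)ᵀ *ᵥ y, ?_,
    fun r => flow (fun r => (σ r).1) r 0 *ᵥ
      ∫ s in (0 : ℝ)..r, inputKernel σ s *ᵥ ((inputKernel σ s)ᵀ *ᵥ y), ⟨?_, fun r hr => ?_⟩, ?_⟩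
  · rw [memLp_indicator_iff_restrict measurableSet_Icc,
      Measure.restrict_restrict measurableSet_Icc,
      inter_eq_left.2 (Icc_subset_Ici_self : Icc 0 t ⊆ Ici 0)]
    obtain ⟨hm, C, hC⟩ := hv
    exact MemLp.of_bound hm C hC
  · exact (mulVecL n n).isBoundedBilinearMap.continuous.comp_continuousOn (hc.prodMk hgc)
  · have hsub : Icc 0 r ⊆ Icc 0 t := Icc_subset_Icc_right hr.2
    have hAΦ := essBddOn_mul_flow hA h0
    -- The product rule for $x=\Phi(\cdot,0)\int NN^Ty$ gives $x'=Ax+\Phi NN^Ty$, and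
    -- $\Phi(s,0)N(s)=B(s)$ turns the last term into $Bu$.
    have key := primitive_mulVec_primitive (C := 1) hr.1 (hAΦ.mono hsub) (hg.mono hsub)
    have hΦN : ∀ s ∈ Icc 0 t, flow (fun r => (σ r).1) s 0 * inputKernel σ s = (σ s).2.1 := by
      intro s hs
      rw [inputKernel, ← Matrix.mul_assoc, flow_mul_flow_self hA hs h0, Matrix.one_mul]
    rw [he r hr, key]
    refine intervalIntegral.integral_congr fun s hs => ?_
    rw [uIcc_of_le hr.1] at hs
    have hst := hsub hs
    simp only [← he s hst, ← Matrix.mulVec_mulVec _ (σ s).1, indicator_of_mem hst,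
      Matrix.mulVec_mulVec _ _ (inputKernel σ s), hΦN s hst]
  · rw [ctrlGramian_mulVec hσ ht]

end VariationOfConstants

/-! ### Piecewise constant signals -/

section PiecewiseConstant

theorem pcSignals_subset_arbSignals {V : Type*} [TopologicalSpace V]
    [TopologicalSpace.PseudoMetrizableSpace V] {M : Set V} {t : ℝ} :
    pcSignals M t ⊆ arbSignals M t := by
  rintro σ ⟨hM, hD, -⟩
  refine ⟨?_, (ae_restrict_mem measurableSet_Icc).mono hM⟩
  set D := {s ∈ Icc 0 t | ¬ ContinuousWithinAt σ (Icc 0 t) s}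
  have hc : ContinuousOn σ (Icc 0 t \ D) := fun s hs =>
    (not_not.1 fun h => hs.2 ⟨hs.1, h⟩ : ContinuousWithinAt σ (Icc 0 t) s).mono sdiff_subset
  have := hc.aestronglyMeasurable_of_isSeparable (μ := volume)
    (measurableSet_Icc.diff hD.measurableSet) (TopologicalSpace.IsSeparable.of_separableSpace _)
  rwa [Measure.restrict_congr_set (sdiff_null_ae_eq_self (hD.measure_zero volume))] at this

theorem const_mem_pcSignals {V : Type*} [TopologicalSpace V] {M : Set V} {v : V} (hv : v ∈ M)
    (t : ℝ) : (fun _ => v) ∈ pcSignals M t := by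
  refine ⟨fun _ _ => hv, ?_, (finite_singleton v).subset (by rintro _ ⟨_, _, rfl⟩; rfl)⟩
  convert finite_empty
  exact eq_empty_of_forall_notMem fun s hs => hs.2 continuousWithinAt_const

/-- The concatenation of the restriction of `σ` to `[0, t]` with `τ`. -/
def concat {V : Type*} (σ τ : ℝ → V) (t : ℝ) (s : ℝ) : V := if s ≤ t then σ s else τ (s - t)

theorem concat_of_le {V : Type*} {σ τ : ℝ → V} {t s : ℝ} (h : s ≤ t) : concat σ τ t s = σ s :=
  if_pos h

theorem concat_of_lt {V : Type*} {σ τ : ℝ → V} {t s : ℝ} (h : t < s) :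
    concat σ τ t s = τ (s - t) := if_neg h.not_ge

theorem concat_mem_pcSignals {V : Type*} [TopologicalSpace V] {M : Set V} {σ τ : ℝ → V} {t h : ℝ}
    (hσ : σ ∈ pcSignals M t) (hτ : τ ∈ pcSignals M h) :
    concat σ τ t ∈ pcSignals M (t + h) := by
  have hsh : ∀ s ∈ Icc 0 (t + h), t < s → s - t ∈ Icc 0 h := fun s hs hst =>
    ⟨by linarith, by linarith [hs.2]⟩
  refine ⟨fun s hs => ?_, ?_, ?_⟩
  · rcases le_or_gt s t with hst | hst
    · rw [concat_of_le hst]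
      exact hσ.1 s ⟨hs.1, hst⟩
    · rw [concat_of_lt hst]
      exact hτ.1 _ (hsh s hs hst)
  -- The junction `t` may be a new discontinuity.
  · refine ((hσ.2.1.union (hτ.2.1.image (· + t))).union (finite_singleton t)).subset ?_
    rintro s ⟨hs, hns⟩
    by_contra hcon
    simp only [mem_union, not_or] at hcon
    obtain ⟨⟨h1, h2⟩, h3⟩ := hcon
    refine hns ?_
    rcases lt_trichotomy s t with hst | hst | hst
    · have hc : ContinuousWithinAt σ (Icc 0 t) s := not_not.1 fun h => h1 ⟨⟨hs.1, hst.le⟩, h⟩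
      have hmem : Icc 0 t ∈ 𝓝[Icc 0 (t + h)] s := by
        filter_upwards [self_mem_nhdsWithin, nhdsWithin_le_nhds (Iio_mem_nhds hst)] with x hx hx'
        exact ⟨hx.1, le_of_lt hx'⟩
      refine (hc.mono_of_mem_nhdsWithin hmem).congr_of_eventuallyEq ?_ (concat_of_le hst.le)
      filter_upwards [nhdsWithin_le_nhds (Iio_mem_nhds hst)] with x hx
      exact concat_of_le (le_of_lt hx)
    · exact absurd hst h3
    · have hc : ContinuousWithinAt τ (Icc 0 h) (s - t) := not_not.1 fun hn =>
        h2 ⟨s - t, ⟨hsh s hs hst, hn⟩, sub_add_cancel s t⟩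
      have hc' : ContinuousWithinAt (fun x => τ (x - t)) (Icc t (t + h)) s :=
        hc.comp (f := fun x => x - t) (by fun_prop)
          fun x hx => ⟨by linarith [hx.1], by linarith [hx.2]⟩
      have hmem : Icc t (t + h) ∈ 𝓝[Icc 0 (t + h)] s := by
        filter_upwards [self_mem_nhdsWithin, nhdsWithin_le_nhds (Ioi_mem_nhds hst)] with x hx hx'
        exact ⟨le_of_lt hx', hx.2⟩
      refine (hc'.mono_of_mem_nhdsWithin hmem).congr_of_eventuallyEq ?_ (concat_of_lt hst)
      filter_upwards [nhdsWithin_le_nhds (Ioi_mem_nhds hst)] with x hx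
      exact concat_of_lt hx
  · refine (hσ.2.2.union hτ.2.2).subset ?_
    rintro _ ⟨s, hs, rfl⟩
    rcases le_or_gt s t with hst | hst
    · rw [concat_of_le hst]
      exact Or.inl ⟨s, ⟨hs.1, hst⟩, rfl⟩
    · rw [concat_of_lt hst]
      exact Or.inr ⟨_, hsh s hs hst, rfl⟩

variable {n m p : ℕ} {M : Set (Triple n m p)}

theorem flow_concat_left {σ τ : ℝ → Triple n m p} {t h : ℝ} (hh : 0 ≤ h)
    (hρ : EssBddOn (concat σ τ t) 0 (t + h)) (hσ : EssBddOn σ 0 t) {r q : ℝ} (hr : r ∈ Icc 0 t)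
    (hq : q ∈ Icc 0 t) :
    flow (fun s => (concat σ τ t s).1) r q = flow (fun s => (σ s).1) r q := by
  have := flow_shift (c := 0) hσ.fst_signal (A' := fun s => (concat σ τ t s).1)
    (by simpa using! (hρ.mono (Icc_subset_Icc_right (by linarith))).fst_signal)
    (fun s hs => by simp only [add_zero, concat_of_le hs.2]) hr hq
  simpa using this

theorem inputKernel_concat_of_le {σ τ : ℝ → Triple n m p} {t h : ℝ} (hh : 0 ≤ h)
    (hρ : EssBddOn (concat σ τ t) 0 (t + h)) (hσ : EssBddOn σ 0 t) {s : ℝ} (hs : s ∈ Icc 0 t) :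
    inputKernel (concat σ τ t) s = inputKernel σ s := by
  rw [inputKernel, inputKernel, concat_of_le hs.2,
    flow_concat_left hh hρ hσ (left_mem_Icc.2 (hs.1.trans hs.2)) hs]

theorem inputKernel_concat_add {σ τ : ℝ → Triple n m p} {t h : ℝ} (ht : 0 ≤ t)
    (hρ : EssBddOn (concat σ τ t) 0 (t + h)) (hσ : EssBddOn σ 0 t) (hτ : EssBddOn τ 0 h) {s : ℝ}
    (hs : s ∈ Ioc 0 h) :
    inputKernel (concat σ τ t) (s + t) =
      flow (fun s => (σ s).1) 0 t * inputKernel τ s := by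
  have hh : 0 ≤ h := hs.1.le.trans hs.2
  have h1 := flow_shift (c := t) hτ.fst_signal (A' := fun s => (concat σ τ t s).1)
    (by rw [add_comm h t]; exact hρ.fst_signal.mono (Icc_subset_Icc_left (by linarith)))
    (fun s hs => by simp only [concat_of_lt (lt_add_of_pos_left t hs.1), add_sub_cancel_right])
    (left_mem_Icc.2 hh) (Ioc_subset_Icc_self hs)
  rw [zero_add] at h1
  rw [inputKernel, inputKernel, concat_of_lt (lt_add_of_pos_left t hs.1), add_sub_cancel_right,
    ← h1, ← flow_concat_left hh hρ hσ (left_mem_Icc.2 ht) (right_mem_Icc.2 ht), ← Matrix.mul_assoc,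
    flow_mul_flow hρ.fst_signal ⟨le_rfl, by linarith⟩ ⟨ht, by linarith⟩
      ⟨by linarith [hs.1], by linarith [hs.2]⟩]

/-- The condition $N^Tw=0$ almost everywhere splits at time `t`; on the second piece $N$ is
$\Phi_\sigma(0,t)$ times the kernel of `τ`. -/
theorem ctrlGramian_mulVec_eq_zero_of_concat {σ τ : ℝ → Triple n m p} {t h : ℝ} (ht : 0 ≤ t)
    (hh : 0 ≤ h) (hρ : EssBddOn (concat σ τ t) 0 (t + h)) (hσ : EssBddOn σ 0 t)
    (hτ : EssBddOn τ 0 h) {w : Fin n → ℝ} (hw : ctrlGramian (concat σ τ t) (t + h) *ᵥ w = 0) :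
    ctrlGramian σ t *ᵥ w = 0 ∧
      ctrlGramian τ h *ᵥ ((flow (fun s => (σ s).1) 0 t)ᵀ *ᵥ w) = 0 := by
  rw [ctrlGramian_mulVec_eq_zero_iff hρ (by linarith)] at hw
  rw [ctrlGramian_mulVec_eq_zero_iff hσ ht, ctrlGramian_mulVec_eq_zero_iff hτ hh]
  constructor
  · filter_upwards [ae_restrict_of_ae_restrict_of_subset
      (Icc_subset_Icc_right (by linarith : t ≤ t + h)) hw,
      ae_restrict_mem measurableSet_Icc] with s h1 h2
    rwa [inputKernel_concat_of_le hh hρ hσ h2] at h1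
  · rw [Measure.restrict_congr_set Ioc_ae_eq_Icc.symm, ae_restrict_iff' measurableSet_Ioc]
    rw [ae_restrict_iff' measurableSet_Icc] at hw
    filter_upwards [(measurePreserving_add_right volume t).quasiMeasurePreserving.ae hw]
      with s h1 h2
    have h3 := h1 ⟨by linarith [h2.1], by linarith [h2.2]⟩
    rwa [inputKernel_concat_add ht hρ hσ hτ h2, Matrix.transpose_mul, ← Matrix.mulVec_mulVec] at h3

/-- A vector annihilated by all Gramians of the constant signal `(A, B, C)` is in the kernel
of `Bᵀ`. -/
theorem input_transpose_mulVec_eq_zero {v : Triple n m p} {w : Fin n → ℝ}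
    (hw : ctrlGramian (fun _ => v) 1 *ᵥ w = 0) : v.2.1ᵀ *ᵥ w = 0 := by
  have hb : EssBddOn (fun _ : ℝ => v) 0 1 := essBddOn_of_continuousOn continuousOn_const
  rw [ctrlGramian_mulVec_eq_zero_iff hb zero_le_one] at hw
  have hfc := flow_continuousOn_right hb.fst_signal (left_mem_Icc.2 zero_le_one)
  have hc : ContinuousOn (fun s => (inputKernel (fun _ => v) s)ᵀ *ᵥ w) (Icc 0 1) :=
    (((mulVecL m n).flip w).comp (transposeL n m)).continuous.comp_continuousOn
      ((Continuous.matrix_mul continuous_id continuous_const).comp_continuousOn hfc)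
  -- By continuity the vanishing holds everywhere, in particular at `s = 0`, where the flow is the
  -- identity.
  have h0 := Measure.eqOn_Icc_of_ae_eq volume zero_ne_one (g := fun _ => 0) hw hc
    continuousOn_const (left_mem_Icc.2 zero_le_one)
  simpa [inputKernel, flow_self hb.fst_signal (left_mem_Icc.2 zero_le_one)] using h0

/-- The difference quotients at $0^+$ of $t\mapsto e^{-tA^T}w$ lie in `K`, which is closed, and
converge to $-A^Tw$. -/
theorem transpose_mulVec_mem_of_flow {A : Matrix (Fin n) (Fin n) ℝ} {K : Submodule ℝ (Fin n → ℝ)}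
    {w : Fin n → ℝ} (hw : w ∈ K) (h : ∀ t > 0, (flow (fun _ => A) 0 t)ᵀ *ᵥ w ∈ K) :
    Aᵀ *ᵥ w ∈ K := by
  let Λ := ((mulVecL n n).flip w).comp (transposeL n n)
  have hd : HasDerivAt (fun t : ℝ => Λ (NormedSpace.exp ((-t) • A)))
      (Λ (-(A * NormedSpace.exp ((-(0 : ℝ)) • A)))) 0 := by
    have h1 := (hasDerivAt_exp_smul_const' A (-(0 : ℝ))).scomp (0 : ℝ) (hasDerivAt_neg (0 : ℝ))
    have h2 := Λ.hasFDerivAt.comp_hasDerivAt (0 : ℝ) h1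
    simpa [Function.comp_def] using! h2
  have hs := (hasDerivWithinAt_iff_tendsto_slope' (s := Ioi (0 : ℝ)) (by simp)).1
    hd.hasDerivWithinAt
  have hmem : -(Aᵀ *ᵥ w) ∈ K := by
    have hval : Λ (-(A * NormedSpace.exp ((-(0 : ℝ)) • A))) = -(Aᵀ *ᵥ w) := by
      simp [Λ]
    rw [hval] at hs
    refine K.closed_of_finiteDimensional.mem_of_tendsto hs ?_
    filter_upwards [self_mem_nhdsWithin] with t ht
    have h1 : Λ (NormedSpace.exp ((-t) • A)) ∈ K := by
      have := h t ht
      rwa [flow_const A t (le_of_lt ht)] at this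
    have h0 : Λ (NormedSpace.exp ((-(0 : ℝ)) • A)) ∈ K := by simpa [Λ] using hw
    rw [slope_def_module]
    exact K.smul_mem _ (K.sub_mem h1 h0)
  simpa using K.neg_mem hmem

/-- Some piecewise constant signal has a controllability Gramian whose kernel is orthogonal to
the reachable subspace. -/
theorem exists_pcSignals_ker_orthogonal (hM : M.Nonempty) (hMb : Bornology.IsBounded M) :
    ∃ t > 0, ∃ σ ∈ pcSignals M t, ∀ w, ctrlGramian σ t *ᵥ w = 0 →
      ∀ v ∈ reachSubspace M, w ⬝ᵥ v = 0 := by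
  let K : ℝ × (ℝ → Triple n m p) → Submodule ℝ (Fin n → ℝ) := fun q =>
    LinearMap.ker (Matrix.mulVecLin (ctrlGramian q.2 q.1))
  have hK : ∀ q w, w ∈ K q ↔ ctrlGramian q.2 q.1 *ᵥ w = 0 := fun q w => by simp [K]
  let S : Set (ℝ × (ℝ → Triple n m p)) := {q | 0 < q.1 ∧ q.2 ∈ pcSignals M q.1}
  obtain ⟨v₀, hv₀⟩ := hM
  have hS : S.Nonempty := ⟨(1, fun _ => v₀), zero_lt_one, const_mem_pcSignals hv₀ 1⟩
  obtain ⟨⟨t, σ⟩, ⟨ht, hσ⟩, hmin⟩ :=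
    (InvImage.wf (fun q => Module.finrank ℝ (K q)) Nat.lt_wfRel.wf).has_min S hS
  have hbd : ∀ {t τ}, τ ∈ pcSignals M t → EssBddOn τ 0 t := fun hτ =>
    essBddOn_of_mem_arbSignals hMb (pcSignals_subset_arbSignals hτ)
  have ht0 : (0 : ℝ) ≤ t := le_of_lt ht
  -- The kernel for `concat σ τ t` lies in that of `σ`, and minimality makes them equal, so each `w`
  -- in the latter also satisfies the condition on the second piece.
  have hadv : ∀ q ∈ S, ∀ w ∈ K (t, σ), (flow (fun s => (σ s).1) 0 t)ᵀ *ᵥ w ∈ K q := by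
    rintro ⟨h, τ⟩ ⟨hh, hτ⟩ w hw
    have hρ := concat_mem_pcSignals hσ hτ
    have hle : K (t + h, concat σ τ t) ≤ K (t, σ) := fun w hw =>
      (ctrlGramian_mulVec_eq_zero_of_concat ht0 (le_of_lt hh) (hbd hρ) (hbd hσ) (hbd hτ) hw).1
    have heq := Submodule.eq_of_le_of_finrank_le hle (not_lt.1 (hmin _ ⟨add_pos ht hh, hρ⟩))
    rw [← heq] at hw
    exact (ctrlGramian_mulVec_eq_zero_of_concat ht0 (le_of_lt hh) (hbd hρ) (hbd hσ) (hbd hτ) hw).2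
  -- Taking `τ = σ` shows that the invertible transposed flow maps the minimal kernel into itself,
  -- hence onto itself; this removes the flow from `hadv`.
  have hmap : (K (t, σ)).map (Matrix.mulVecLin (flow (fun s => (σ s).1) 0 t)ᵀ) = K (t, σ) := by
    refine Submodule.eq_of_le_of_finrank_eq ?_ ?_
    · rintro _ ⟨w, hw, rfl⟩
      exact hadv (t, σ) ⟨ht, hσ⟩ w hw
    · refine (LinearEquiv.finrank_eq (Submodule.equivMapOfInjective _ ?_ _)).symm
      have hinv : (flow (fun s => (σ s).1) t 0)ᵀ * (flow (fun s => (σ s).1) 0 t)ᵀ = 1 := by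
        rw [← Matrix.transpose_mul, flow_mul_flow_self (hbd hσ).fst_signal (left_mem_Icc.2 ht0)
          (right_mem_Icc.2 ht0), Matrix.transpose_one]
      intro x y hxy
      have := congrArg (fun z => (flow (fun s => (σ s).1) t 0)ᵀ *ᵥ z) hxy
      simpa only [Matrix.mulVecLin_apply, Matrix.mulVec_mulVec, hinv, Matrix.one_mulVec] using this
  have hall : ∀ q ∈ S, K (t, σ) ≤ K q := by
    intro q hq w hw
    rw [← hmap] at hw
    obtain ⟨w', hw', rfl⟩ := hw
    exact hadv q hq w' hw'
  refine ⟨t, ht, σ, hσ, fun w hw v hv => dotProduct_eq_zero_of_mem_reachSubspace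
    (K := K (t, σ)) (fun x hx w hw => ?_) (fun x hx w hw => ?_) ((hK _ _).2 hw) hv⟩
  -- The constant signal `x` now comes before `σ`, so the condition on the second piece says that
  -- $e^{-hA^T}$ maps the minimal kernel into itself.
  · refine transpose_mulVec_mem_of_flow hw fun h hh => ?_
    have hc := const_mem_pcSignals hx h
    have hρ := concat_mem_pcSignals hc hσ
    exact (ctrlGramian_mulVec_eq_zero_of_concat (le_of_lt hh) ht0 (hbd hρ) (hbd hc) (hbd hσ)
      (hall (h + t, concat (fun _ => x) σ h) ⟨add_pos hh ht, hρ⟩ hw)).2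
  · exact input_transpose_mulVec_eq_zero (hall (1, fun _ => x)
      ⟨zero_lt_one, const_mem_pcSignals hx 1⟩ hw)

end PiecewiseConstant

/-! ### Analytic continuation of the rank condition -/

section Analytic

variable {n m p : ℕ} {M : Set (Triple n m p)}

theorem AnalyticOn.matrix_det {f : ℝ → Matrix (Fin n) (Fin n) ℝ} {s : Set ℝ}
    (hf : AnalyticOn ℝ f s) : AnalyticOn ℝ (fun l => (f l).det) s := by
  have he : ∀ i j, AnalyticOn ℝ (fun l => f l i j) s := fun i j =>
    (LinearMap.toContinuousLinearMap (Matrix.entryLinearMap ℝ ℝ i j)).comp_analyticOn hf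
  simp only [Matrix.det_apply']
  exact Finset.analyticOn_fun_sum _ fun σ _ =>
    analyticOn_const.mul (Finset.analyticOn_fun_prod _ fun i _ => he _ _)

/-- An analytic function on `[0, 1]` not vanishing at `1` does not vanish identically on a subset
of `[0, 1]` with nonempty interior. -/
theorem exists_ne_zero_of_analyticOn_Icc {f : ℝ → ℝ} (hf : AnalyticOn ℝ f (Icc 0 1))
    (h1 : f 1 ≠ 0) {S : Set ℝ} (hS : S ⊆ Icc 0 1) (hSi : (interior S).Nonempty) :
    ∃ l ∈ S, f l ≠ 0 := by
  by_contra! hcon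
  obtain ⟨x, hx⟩ := hSi
  have hsub : interior S ⊆ Ioo 0 1 := by
    rw [← interior_Icc]
    exact interior_mono hS
  have han : AnalyticOnNhd ℝ f (Ioo 0 1) := by
    rw [← isOpen_Ioo.analyticOn_iff_analyticOnNhd]
    exact hf.mono Ioo_subset_Icc_self
  have hz : EqOn f 0 (Ioo 0 1) := by
    refine han.eqOn_zero_of_preconnected_of_eventuallyEq_zero isPreconnected_Ioo (hsub hx) ?_
    filter_upwards [isOpen_interior.mem_nhds hx] with y hy
    exact hcon y (interior_subset hy)
  -- The identity theorem acts on the open interval; continuity carries the vanishing to the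
  -- endpoint `1`.
  have hcl : EqOn f 0 (Icc 0 1) :=
    hz.of_subset_closure hf.continuousOn continuousOn_const Ioo_subset_Icc_self
      (closure_Ioo zero_ne_one).superset
  exact h1 (hcl (right_mem_Icc.2 zero_le_one))

/-- Adding `P` turns the rank condition into the nonvanishing of one determinant: Gramians have
range in $V=\ker P$, so invertibility of $W+P$ forces the range of $W$ to be all of $V$. -/
theorem exists_mem_range_ctrlGramian_eq (hM : M.Nonempty) (hMb : Bornology.IsBounded M)
    {G : ℝ → Set (ℝ → Triple n m p)} (hT2 : AssumptionT2 M G) :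
    ∃ t > 0, ∃ σ ∈ G t, σ ∈ arbSignals M t ∧
      LinearMap.range (Matrix.mulVecLin (ctrlGramian σ t)) = reachSubspace M := by
  obtain ⟨t, ht, σ, hσ, hker⟩ := exists_pcSignals_ker_orthogonal hM hMb
  obtain ⟨P, hP, hPV⟩ := exists_projection_with_ker (reachSubspace M)
  have hsum : ∀ {t : ℝ} {σ : ℝ → Triple n m p}, 0 ≤ t → σ ∈ arbSignals M t → ∀ y,
      P *ᵥ ((ctrlGramian σ t + P) *ᵥ y) = P *ᵥ y := by
    intro t σ ht hσ y
    rw [Matrix.add_mulVec, Matrix.mulVec_add, (hPV _).2 (ctrlGramian_mulVec_mem hMb ht hσ y),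
      zero_add, Matrix.mulVec_mulVec, hP]
  have hdet : (ctrlGramian σ t + P).det ≠ 0 := by
    rw [Ne, ← Matrix.exists_mulVec_eq_zero_iff]
    rintro ⟨x, hx0, hx⟩
    -- Applying `P` to $(W+P)x=0$ gives $Px=0$. Then $x\in V$ and $Wx=0$, so $x$ is orthogonal to
    -- itself.
    have hPx := hsum ht.le (pcSignals_subset_arbSignals hσ) x
    rw [hx, Matrix.mulVec_zero, eq_comm] at hPx
    rw [Matrix.add_mulVec, hPx, add_zero] at hx
    exact hx0 (dotProduct_self_eq_zero.1 (hker x hx x ((hPV x).1 hPx)))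
  have hcont : Continuous fun X : Matrix (Fin n) (Fin n) ℝ => (X + P).det := by fun_prop
  obtain ⟨ε, hε, hball⟩ := Metric.isOpen_iff.1 (hcont.isOpen_preimage _ isOpen_compl_singleton)
    (ctrlGramian σ t) hdet
  obtain ⟨tl, σl, harb, han, hc, -, hint⟩ := hT2.gramians t ht (ε / 2) (half_pos hε) σ hσ
  have h1 : (ctrlGramian (σl 1) (tl 1) + P).det ≠ 0 :=
    hball (by rw [mem_ball_iff_norm]; linarith)
  have han' : AnalyticOn ℝ (fun l => (ctrlGramian (σl l) (tl l) + P).det) (Icc 0 1) :=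
    AnalyticOn.matrix_det
      (((ContinuousLinearMap.fst ℝ _ _).comp_analyticOn han).add analyticOn_const)
  obtain ⟨l, ⟨hl, hlG⟩, hne⟩ := exists_ne_zero_of_analyticOn_Icc han' h1 (fun l hl => hl.1) hint
  obtain ⟨hpos, hla⟩ := harb l hl
  refine ⟨tl l, hpos, σl l, hlG, hla, le_antisymm ?_ fun v hv => ?_⟩
  · rintro _ ⟨y, rfl⟩
    exact ctrlGramian_mulVec_mem hMb hpos.le hla y
  · have hu : IsUnit (ctrlGramian (σl l) (tl l) + P).det := isUnit_iff_ne_zero.2 hne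
    set y := (ctrlGramian (σl l) (tl l) + P)⁻¹ *ᵥ v
    have hy : (ctrlGramian (σl l) (tl l) + P) *ᵥ y = v := by
      rw [Matrix.mulVec_mulVec, Matrix.mul_nonsing_inv _ hu, Matrix.one_mulVec]
    have hPy := hsum hpos.le hla y
    rw [hy, (hPV v).2 hv, eq_comm] at hPy
    refine ⟨y, ?_⟩
    rwa [Matrix.add_mulVec, hPy, add_zero] at hy

theorem reachableSet_mono {G H : ℝ → Set (ℝ → Triple n m p)} (h : ∀ t ≥ 0, G t ⊆ H t) :
    reachableSet G ⊆ reachableSet H := by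
  rintro z ⟨t, ht, σ, hσ, hz⟩
  exact ⟨t, ht, σ, h t ht hσ, hz⟩

theorem reachableSet_arbSignals_subset (hMb : Bornology.IsBounded M) :
    reachableSet (arbSignals M) ⊆ (reachSubspace M : Set (Fin n → ℝ)) := by
  rintro z ⟨t, ht, σ, hσ, u, -, x, hx, rfl⟩
  exact trajectory_mem_reachSubspace hMb ht hσ hx

theorem flow_mulVec_mem_reachSubspace (hMb : Bornology.IsBounded M) {t r s : ℝ}
    {σ : ℝ → Triple n m p} (hσ : σ ∈ arbSignals M t) (hr : r ∈ Icc 0 t) (hs : s ∈ Icc 0 t)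
    {v : Fin n → ℝ} (hv : v ∈ reachSubspace M) :
    flow (fun r => (σ r).1) r s *ᵥ v ∈ reachSubspace M := by
  obtain ⟨P, hP, hPV⟩ := exists_projection_with_ker (reachSubspace M)
  have h := projection_mul_flow hP hPV hMb hσ hr hs
  rw [mul_sub, mul_one, sub_eq_zero] at h
  rw [← hPV, Matrix.mulVec_mulVec, h, ← Matrix.mulVec_mulVec, (hPV v).2 hv, Matrix.mulVec_zero]

theorem reachSubspace_subset_reachableSet (hMb : Bornology.IsBounded M)
    {G : ℝ → Set (ℝ → Triple n m p)} {t : ℝ} (ht : 0 ≤ t) {σ : ℝ → Triple n m p}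
    (hσ : σ ∈ G t) (ha : σ ∈ arbSignals M t)
    (hr : LinearMap.range (Matrix.mulVecLin (ctrlGramian σ t)) = reachSubspace M) :
    (reachSubspace M : Set (Fin n → ℝ)) ⊆ reachableSet G := by
  intro v hv
  have hb := essBddOn_of_mem_arbSignals hMb ha
  have h0 : (0 : ℝ) ∈ Icc 0 t := left_mem_Icc.2 ht
  have ht' : t ∈ Icc 0 t := right_mem_Icc.2 ht
  -- To reach `v`, solve $Wy=\Phi(0,t)v$; the right side is in $V$, the range of $W$, and
  -- $\Phi(t,0)$ brings it back to `v`.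
  have hmem := flow_mulVec_mem_reachSubspace hMb ha h0 ht' hv
  rw [← hr] at hmem
  obtain ⟨y, hy⟩ := hmem
  obtain ⟨u, hu, x, hx, hxt⟩ := exists_trajectory hb ht y
  refine ⟨t, ht, σ, hσ, u, hu, x, hx, ?_⟩
  rw [Matrix.mulVecLin_apply] at hy
  rw [hxt, hy, Matrix.mulVec_mulVec, flow_mul_flow_self hb.fst_signal ht' h0, Matrix.one_mulVec]

end Analytic

end SwitchedSystem

end

theorem mainTheorem8 {n m p : ℕ}
    (M : Set (SwitchedSystem.Triple n m p)) (hM : M.Nonempty) (hMb : Bornology.IsBounded M)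
    (T : Set (ℝ → SwitchedSystem.Triple n m p))
    (hT : T ⊆ SwitchedSystem.arbSignalsInfinite M)
    (G : ℝ → Set (ℝ → SwitchedSystem.Triple n m p))
    (hG : ∀ t ≥ 0, G t ⊆ SwitchedSystem.arbSignals M t)
    (hGT : SwitchedSystem.concatInfinite G ⊆ T)
    (hT2 : SwitchedSystem.AssumptionT2 M G) :
    SwitchedSystem.reachableSet G = SwitchedSystem.reachableSet (SwitchedSystem.arbSignals M) ∧
    SwitchedSystem.reachableSet (SwitchedSystem.arbSignals M) =
      (SwitchedSystem.reachSubspace M : Set (Fin n → ℝ)) ∧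
    ∃ t > 0, ∃ σ ∈ G t,
      LinearMap.range (Matrix.mulVecLin (SwitchedSystem.ctrlGramian σ t)) =
        SwitchedSystem.reachSubspace M := by 
  obtain ⟨t, ht, σ, hσ, ha, hr⟩ :=
    SwitchedSystem.exists_mem_range_ctrlGramian_eq hM hMb hT2
  have h1 := SwitchedSystem.reachSubspace_subset_reachableSet hMb ht.le hσ ha hr
  have h2 := SwitchedSystem.reachableSet_mono hG
  have h3 := SwitchedSystem.reachableSet_arbSignals_subset hMb
  exact ⟨h2.antisymm (h3.trans h1), h3.antisymm (h1.trans h2), t, ht, σ, hσ, hr⟩
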